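/- Let $p\ge 1$, $q\ge 2$ be integers and $n=p+q-2$ (so $n\ge 1$). On $\mathbb{C}^{n+2}$ with basis $e_0,\dots,e_{n+1}$ consider the quadratic form $2x_0x_{n+1}+\sum_{i=1}^{n}\epsilon_i x_i^2$, where $\epsilon_i=1$ for $1\le i\le p-1$ and $\epsilon_i=-1$ for $p\le i\le n$. Let $\mathfrak{g}\simeq\mathfrak{so}(n+2,\mathbb{C})$ be the complex Lie algebra of matrices that are skew with respect to this form, $\mathfrak{p}\subset\mathfrak{g}$ the parabolic subalgebra stabilizing the isotropic line $\mathbb{C}e_0$, $\mathfrak{g}'=\{X\in\mathfrak{g}: Xe_n=0\}\simeq\mathfrak{so}(n+1,\mathbb{C})$ and $\mathfrak{p}'=\mathfrak{p}\cap\mathfrak{g}'$. For $\lambda\in\mathbb{C}$ let $\mathbb{C}_\lambda$ be the one-dimensional representation of $\mathfrak{p}$, or of $\mathfrak{p}'$, on which $X$ acts by $\lambda X_{00}$ (with $X_{00}$ the upper left matrix entry), and let $$M^{\mathfrak{g}}_{\mathfrak{p}}(\lambda)=U(\mathfrak{g})\otimes_{U(\mathfrak{p})}\mathbb{C}_\lambda,\qquad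 M^{\mathfrak{g}'}_{\mathfrak{p}'}(\lambda)=U(\mathfrak{g}')\otimes_{U(\mathfrak{p}')}\mathbb{C}_\lambda$$ be the scalar generalized Verma modules. **Theorem.** For every $\lambda\in\mathbb{C}\setminus\{\tfrac12(k-n): k=2,3,4,\dots\}$ the generalized Verma module $M^{\mathfrak{g}}_{\mathfrak{p}}(\lambda)$, restricted to $\mathfrak{g}'$, decomposes as a direct sum of generalized Verma modules: there is an isomorphism of $\mathfrak{g}'$-modules $$M^{\mathfrak{g}}_{\mathfrak{p}}(\lambda)|_{\mathfrak{g}'}\;\simeq\;\bigoplus_{b\in\mathbb{N}}M^{\mathfrak{g}'}_{\mathfrak{p}'}(\lambda-b),\qquad \mathbb{N}=\{0,1,2,\dots\}.$$ -/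

import Mathlib

noncomputable section

namespace BranchingVerma

open scoped TensorProduct DirectSum

attribute [local instance 100] LieRing.ofAssociativeRing

/-! ### Induced modules `U(g) ⊗_{U(p)} V` -/

section Induced

variable (R : Type*) [CommRing R] {L : Type*} [LieRing L] [LieAlgebra R L]

/-- The algebra morphism `U(p) → U(g)` induced by the inclusion of a Lie subalgebra `p ⊆ g`. -/
def envIncl (P : LieSubalgebra R L) :
    UniversalEnvelopingAlgebra R P →ₐ[R] UniversalEnvelopingAlgebra R L :=
  UniversalEnvelopingAlgebra.lift R ((UniversalEnvelopingAlgebra.ι R).comp P.incl)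

/-- The action of `U(L)` on an `L`-module `V`. -/
def envAct (L : Type*) [LieRing L] [LieAlgebra R L]
    (V : Type*) [AddCommGroup V] [Module R V] [LieRingModule L V] [LieModule R L V] :
    UniversalEnvelopingAlgebra R L →ₐ[R] Module.End R V :=
  UniversalEnvelopingAlgebra.lift R (LieModule.toEnd R L V)

variable (P : LieSubalgebra R L)
  (V : Type*) [AddCommGroup V] [Module R V] [LieRingModule P V] [LieModule R P V]

/-- The `U(g)`-submodule of `U(g) ⊗_R V` generated by all
`u a ⊗ v - u ⊗ a v` with `u ∈ U(g)`, `a ∈ U(p)`, `v ∈ V`. -/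
def balancedSubmodule :
    Submodule (UniversalEnvelopingAlgebra R L) (UniversalEnvelopingAlgebra R L ⊗[R] V) :=
  Submodule.span _ { t | ∃ (u : UniversalEnvelopingAlgebra R L)
    (a : UniversalEnvelopingAlgebra R P) (v : V),
    t = (u * envIncl R P a) ⊗ₜ[R] v - u ⊗ₜ[R] (envAct R P V a v) }

/-- The induced `g`-module `U(g) ⊗_{U(p)} V`, the tensor product over the (noncommutative) ring
`U(p)` being the quotient of `U(g) ⊗_R V` by the balancing relations. -/
def InducedModule : Type _ :=
  (UniversalEnvelopingAlgebra R L ⊗[R] V) ⧸ balancedSubmodule R P V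

namespace InducedModule

instance : AddCommGroup (InducedModule R P V) :=
  inferInstanceAs (AddCommGroup
    ((UniversalEnvelopingAlgebra R L ⊗[R] V) ⧸ balancedSubmodule R P V))

instance : Module (UniversalEnvelopingAlgebra R L) (InducedModule R P V) :=
  inferInstanceAs (Module (UniversalEnvelopingAlgebra R L)
    ((UniversalEnvelopingAlgebra R L ⊗[R] V) ⧸ balancedSubmodule R P V))

instance : Module R (InducedModule R P V) :=
  inferInstanceAs (Module R
    ((UniversalEnvelopingAlgebra R L ⊗[R] V) ⧸ balancedSubmodule R P V))

instance : IsScalarTower R (UniversalEnvelopingAlgebra R L) (InducedModule R P V) :=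
  inferInstanceAs (IsScalarTower R (UniversalEnvelopingAlgebra R L)
    ((UniversalEnvelopingAlgebra R L ⊗[R] V) ⧸ balancedSubmodule R P V))

/-- `x ∈ g` acts as left multiplication by its image in `U(g)`. -/
instance : LieRingModule L (InducedModule R P V) where
  bracket x m := (UniversalEnvelopingAlgebra.ι R x : UniversalEnvelopingAlgebra R L) • m
  add_lie x y m := by
    change UniversalEnvelopingAlgebra.ι R (x + y) • m = _
    rw [map_add, add_smul]
  lie_add x m n := smul_add _ m n
  leibniz_lie x y m := by
    change UniversalEnvelopingAlgebra.ι R x • UniversalEnvelopingAlgebra.ι R y • m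
      = UniversalEnvelopingAlgebra.ι R ⁅x, y⁆ • m
        + UniversalEnvelopingAlgebra.ι R y • UniversalEnvelopingAlgebra.ι R x • m
    rw [LieHom.map_lie, LieRing.of_associative_ring_bracket, sub_smul, mul_smul, mul_smul]
    abel

instance : LieModule R L (InducedModule R P V) where
  smul_lie r x m := by
    change UniversalEnvelopingAlgebra.ι R (r • x) • m = r • UniversalEnvelopingAlgebra.ι R x • m
    rw [map_smul, smul_assoc]
  lie_smul r x m := by
    change UniversalEnvelopingAlgebra.ι R x • r • m = r • UniversalEnvelopingAlgebra.ι R x • m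
    rw [← algebraMap_smul (UniversalEnvelopingAlgebra R L) r m,
      ← algebraMap_smul (UniversalEnvelopingAlgebra R L) r
        (UniversalEnvelopingAlgebra.ι R x • m), smul_smul, smul_smul, Algebra.commutes]

end InducedModule

end Induced

/-! ### One-dimensional modules -/

section CharModule

variable {R : Type*} [CommRing R] {L : Type*} [LieRing L] [LieAlgebra R L]

/-- The one-dimensional `L`-module on which `x` acts as multiplication by `χ x`. -/
def CharModule (_χ : LieAlgebra.LieCharacter R L) : Type _ := R

variable (χ : LieAlgebra.LieCharacter R L)

instance : AddCommGroup (CharModule χ) := inferInstanceAs (AddCommGroup R)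

instance : Module R (CharModule χ) := inferInstanceAs (Module R R)

instance : LieRingModule L (CharModule χ) where
  bracket x v := χ x • v
  add_lie x y v := by
    rw [map_add, add_smul]
  lie_add x v w := smul_add _ v w
  leibniz_lie x y v := by
    change χ x • χ y • v = χ ⁅x, y⁆ • v + χ y • χ x • v
    rw [LieAlgebra.lieCharacter_apply_lie, zero_smul, zero_add, smul_comm]

instance : LieModule R L (CharModule χ) where
  smul_lie r x v := by
    change χ (r • x) • v = r • χ x • v
    rw [map_smul, smul_assoc]
  lie_smul r x v := by
    change χ x • r • v = r • χ x • v
    rw [smul_comm]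

end CharModule

/-! ### The orthogonal Lie algebras -/

/-- The matrix, in the basis `e_0, …, e_{n+1}`, of the quadratic form
`2 x_0 x_{n+1} + ∑_{i=1}^n ε_i x_i²`, where `ε_i = 1` for `1 ≤ i ≤ p - 1` and `ε_i = -1` for
`p ≤ i ≤ n`. -/
def gram (n p : ℕ) : Matrix (Fin (n + 2)) (Fin (n + 2)) ℂ :=
  Matrix.of fun i j =>
    if (i = 0 ∧ j = Fin.last (n + 1)) ∨ (i = Fin.last (n + 1) ∧ j = 0) then 1
    else if i = j ∧ i ≠ 0 ∧ i ≠ Fin.last (n + 1) then (if (i : ℕ) < p then 1 else -1)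
    else 0

/-- `g = so(n+2, ℂ)`: the complex matrices `X` with `Xᵀ J = - J X`, where `J` is the matrix of the
quadratic form. -/
abbrev soG (n p : ℕ) : LieSubalgebra ℂ (Matrix (Fin (n + 2)) (Fin (n + 2)) ℂ) :=
  skewAdjointMatricesLieSubalgebra (gram n p)

/-- The parabolic subalgebra `p ⊆ g`: the stabilizer of the isotropic line `ℂ e_0`. -/
def parabolic (n p : ℕ) : LieSubalgebra ℂ (soG n p) where
  carrier := { X | ∀ i, i ≠ 0 → X.1 i 0 = 0 }
  zero_mem' := fun _ _ => rfl
  add_mem' := by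
    intro X Y hX hY i hi
    simp [hX i hi, hY i hi]
  smul_mem' := by
    intro c X hX i hi
    simp [hX i hi]
  lie_mem' := by
    intro X Y hX hY i hi
    have h : ∀ A B : Matrix (Fin (n + 2)) (Fin (n + 2)) ℂ, (∀ i, i ≠ 0 → A i 0 = 0) →
        (∀ i, i ≠ 0 → B i 0 = 0) → (A * B) i 0 = 0 := by
      intro A B hA hB
      rw [Matrix.mul_apply]
      refine Finset.sum_eq_zero fun j _ => ?_
      by_cases hj : j = 0
      · rw [hj, hA i hi, zero_mul]
      · rw [hB j hj, mul_zero]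
    change (X.1 * Y.1 - Y.1 * X.1) i 0 = 0
    rw [Matrix.sub_apply, h _ _ hX hY, h _ _ hY hX, sub_zero]

/-- `g' = so(n+1, ℂ)`: the subalgebra of `g` annihilating the basis vector `e_n`. -/
def soG' (n p : ℕ) : LieSubalgebra ℂ (soG n p) where
  carrier := { X | X.1.mulVec (Pi.single (Fin.castSucc (Fin.last n)) 1) = 0 }
  zero_mem' := Matrix.zero_mulVec _
  add_mem' := by
    intro X Y hX hY
    change (X.1 + Y.1).mulVec _ = 0
    rw [Matrix.add_mulVec, hX, hY, add_zero]
  smul_mem' := by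
    intro c X hX
    change (c • X.1).mulVec _ = 0
    rw [Matrix.smul_mulVec, hX, smul_zero]
  lie_mem' := by
    intro X Y hX hY
    change (X.1 * Y.1 - Y.1 * X.1).mulVec _ = 0
    rw [Matrix.sub_mulVec, ← Matrix.mulVec_mulVec, ← Matrix.mulVec_mulVec, hX, hY,
      Matrix.mulVec_zero, Matrix.mulVec_zero, sub_zero]

/-- The parabolic subalgebra `p' = p ∩ g'` of `g'`. -/
def parabolic' (n p : ℕ) : LieSubalgebra ℂ (soG' n p) :=
  (parabolic n p).comap (soG' n p).incl

lemma lie_apply_zero_zero {n p : ℕ} {X Y : soG n p}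
    (hX : X ∈ parabolic n p) (hY : Y ∈ parabolic n p) : (⁅X, Y⁆ : soG n p).1 0 0 = 0 := by
  have h : ∀ A B : Matrix (Fin (n + 2)) (Fin (n + 2)) ℂ,
      (∀ i, i ≠ 0 → B i 0 = 0) → (A * B) 0 0 = A 0 0 * B 0 0 := by
    intro A B hB
    rw [Matrix.mul_apply]
    refine Finset.sum_eq_single_of_mem 0 (Finset.mem_univ _) fun j _ hj => ?_
    rw [hB j hj, mul_zero]
  change (X.1 * Y.1 - Y.1 * X.1) 0 0 = 0
  rw [Matrix.sub_apply, h _ _ hY, h _ _ hX]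
  ring

/-- The character `X ↦ lam * X_{00}` of `p`: the differential of `a ↦ a ^ lam`, where `a` is the
upper left matrix entry. It is trivial on the nilradical of `p` and on the factor `so(n, ℂ)` of
the Levi part. -/
def chi (n p : ℕ) (lam : ℂ) : LieAlgebra.LieCharacter ℂ (parabolic n p) where
  toFun X := lam * X.1.1 0 0
  map_add' X Y := mul_add lam (X.1.1 0 0) (Y.1.1 0 0)
  map_smul' c X := mul_left_comm lam c (X.1.1 0 0)
  map_lie' := by
    intro X Y
    change lam * (⁅X.1, Y.1⁆ : soG n p).1 0 0 = ⁅_, _⁆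
    rw [lie_apply_zero_zero X.2 Y.2, mul_zero, LieRing.of_associative_ring_bracket, mul_comm,
      sub_self]

/-- The same character `X ↦ lam * X_{00}`, on `p'`. -/
def chi' (n p : ℕ) (lam : ℂ) : LieAlgebra.LieCharacter ℂ (parabolic' n p) where
  toFun X := lam * X.1.1.1 0 0
  map_add' X Y := mul_add lam (X.1.1.1 0 0) (Y.1.1.1 0 0)
  map_smul' c X := mul_left_comm lam c (X.1.1.1 0 0)
  map_lie' := by
    intro X Y
    change lam * (⁅X.1.1, Y.1.1⁆ : soG n p).1 0 0 = ⁅_, _⁆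
    rw [lie_apply_zero_zero (X := X.1.1) (Y := Y.1.1) X.2 Y.2, mul_zero, LieRing.of_associative_ring_bracket, mul_comm,
      sub_self]

/-- The scalar generalized Verma module `U(g) ⊗_{U(p)} ℂ_lam` of `g`. -/
abbrev VermaG (n p : ℕ) (lam : ℂ) : Type :=
  InducedModule ℂ (parabolic n p) (CharModule (chi n p lam))

/-- The scalar generalized Verma module `U(g') ⊗_{U(p')} ℂ_lam` of `g'`. -/
abbrev VermaG' (n p : ℕ) (lam : ℂ) : Type :=
  InducedModule ℂ (parabolic' n p) (CharModule (chi' n p lam))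

end BranchingVerma

end

noncomputable section

namespace BranchingVerma

open scoped TensorProduct DirectSum

attribute [local instance 100] LieRing.ofAssociativeRing

/-! ### Maps out of induced modules and a spanning set -/

section Induced

variable {R : Type*} [CommRing R] {L : Type*} [LieRing L] [LieAlgebra R L]

/-! Write 𝔫₋, 𝔫₊ for the two abelian nilradicals complementary to the Levi part ℂ ⊕ so(n) of g. The
module M(lam) ought to be the polynomial ring on 𝔫₋, and this model is built by hand: 𝔫₋ acts by
multiplication by the variables, the grading element by lam − E (E the Euler field), so(n) by linear
vector fields, and w ∈ 𝔫₊ by the second-order operator (lam − E)∂_w + ⟨εw, x⟩Δ/2 (`conf`). The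
commutator identity `conf_commutator` makes this a representation, `model`. The constant 1 has the
weight of the generator, which gives a map M(lam) → `model`. Polynomials in 𝔫₋ applied to the
generator span M(lam) (`exists_mvPolynomial_surjective`), and the composite of the two maps is the
identity of the polynomial ring. So both are isomorphisms, without any appeal to the PBW theorem.

Now let t be the variable normal to g', x' the m = n − 1 tangential ones and q their quadratic form.
The nilradical 𝔫₋ ∩ g' multiplies by the x'. For each b there is a p'-singular vector s_b = ∑ c_j
q^j t^(b−2j) of weight lam − b. Invariance under rotations is built into the shape of s_b, and
annihilation by 𝔫₊ ∩ g' is a two-term recursion for the c_j with denominators (j+1)(2(lam − b + 1) +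
2j + m) (`nplus_singularVec`). The excluded values of lam keep these from vanishing.

Since c_0 = 1 and q does not involve t, s_b is monic in t of degree b. Hence the s_b form a basis of
ℂ[x'][t] over ℂ[x'] (`exists_singularVec_basis`). The map M'(lam − b) → `model` determined by s_b
sends f(𝔫₋ ∩ g') · generator to f · s_b, so the basis property says precisely that the sum of these
maps is bijective (`bijective_toModule_of_basis`). -/

/-- The enveloping algebra is generated by the Lie algebra. -/
lemma adjoin_range_envι :
    Algebra.adjoin R (Set.range (UniversalEnvelopingAlgebra.ι R (L := L))) = ⊤ := by
  set S := Algebra.adjoin R (Set.range (UniversalEnvelopingAlgebra.ι R (L := L)))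
  let f : L →ₗ⁅R⁆ S :=
    { toFun := fun x => ⟨UniversalEnvelopingAlgebra.ι R x, Algebra.subset_adjoin ⟨x, rfl⟩⟩
      map_add' := fun x y => Subtype.ext (map_add _ x y)
      map_smul' := fun c x => Subtype.ext (map_smul _ c x)
      map_lie' := fun {x y} => Subtype.ext (LieHom.map_lie _ x y) }
  -- Uniqueness in the universal property: a retraction onto `S` that fixes the generators is the
  -- identity, so `S` is everything.
  have h : S.val.comp (UniversalEnvelopingAlgebra.lift R f) = AlgHom.id R _ := by
    apply UniversalEnvelopingAlgebra.hom_ext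
    ext x
    change ((UniversalEnvelopingAlgebra.lift R f (UniversalEnvelopingAlgebra.ι R x) : S) :
      UniversalEnvelopingAlgebra R L) = UniversalEnvelopingAlgebra.ι R x
    rw [UniversalEnvelopingAlgebra.lift_ι_apply]
    rfl
  rw [eq_top_iff]
  intro u _
  have := DFunLike.congr_fun h u
  change ((UniversalEnvelopingAlgebra.lift R f u : S) : UniversalEnvelopingAlgebra R L) = u at this
  rw [← this]
  exact Subtype.property _

variable {P : LieSubalgebra R L} {χ : LieAlgebra.LieCharacter R P}

/-- The underlying scalar of an element of a one-dimensional module. -/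
def CharModule.val (χ : LieAlgebra.LieCharacter R P) : CharModule χ ≃ₗ[R] R :=
  LinearEquiv.refl R R

lemma envAct_charModule (a : UniversalEnvelopingAlgebra R P) (c : CharModule χ) :
    envAct R P (CharModule χ) a c = (UniversalEnvelopingAlgebra.lift R χ a : R) • c := by
  have ha : a ∈ Algebra.adjoin R (Set.range (UniversalEnvelopingAlgebra.ι R (L := P))) := by
    rw [adjoin_range_envι]; trivial
  induction ha using Algebra.adjoin_induction generalizing c with
  | mem x hx =>
    obtain ⟨y, rfl⟩ := hx
    rw [envAct, UniversalEnvelopingAlgebra.lift_ι_apply, UniversalEnvelopingAlgebra.lift_ι_apply]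
    rfl
  | algebraMap r => simp
  | add x y _ _ hx hy => simp [hx, hy, add_smul]
  | mul x y _ _ hx hy => simp [hx, hy, mul_smul]

/-- The projection from `U(g) ⊗ V` to the induced module. -/
def InducedModule.proj (χ : LieAlgebra.LieCharacter R P) :
    UniversalEnvelopingAlgebra R L ⊗[R] CharModule χ →ₗ[UniversalEnvelopingAlgebra R L]
      InducedModule R P (CharModule χ) :=
  (balancedSubmodule R P (CharModule χ)).mkQ

lemma InducedModule.proj_surjective : Function.Surjective (InducedModule.proj χ) :=
  Submodule.mkQ_surjective _

/-- The canonical generator `1 ⊗ 1` of a module induced from a character. -/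
def vacuum (χ : LieAlgebra.LieCharacter R P) : InducedModule R P (CharModule χ) :=
  InducedModule.proj χ (1 ⊗ₜ[R] (CharModule.val χ).symm 1)

lemma lie_eq_env_smul (x : L) (m : InducedModule R P (CharModule χ)) :
    ⁅x, m⁆ = UniversalEnvelopingAlgebra.ι R x • m := rfl

lemma env_smul_vacuum (u : UniversalEnvelopingAlgebra R L) :
    u • vacuum χ = InducedModule.proj χ (u ⊗ₜ[R] (CharModule.val χ).symm 1) := by
  rw [vacuum, ← map_smul, TensorProduct.smul_tmul', smul_eq_mul, mul_one]

lemma exists_env_smul_vacuum (m : InducedModule R P (CharModule χ)) :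
    ∃ u : UniversalEnvelopingAlgebra R L, u • vacuum χ = m := by
  obtain ⟨t, rfl⟩ := InducedModule.proj_surjective m
  induction t using TensorProduct.induction_on with
  | zero => exact ⟨0, by rw [zero_smul, map_zero]⟩
  | tmul u c =>
    refine ⟨CharModule.val χ c • u, ?_⟩
    rw [env_smul_vacuum, TensorProduct.smul_tmul, ← map_smul, smul_eq_mul, mul_one,
      LinearEquiv.symm_apply_apply]
  | add s t hs ht =>
    obtain ⟨u, hu⟩ := hs
    obtain ⟨w, hw⟩ := ht
    exact ⟨u + w, by rw [add_smul, hu, hw, map_add]⟩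

/-- This is the balancing relation with u = 1 and a the image of x in U(P). -/
lemma lie_vacuum (x : P) : ⁅(x : L), vacuum χ⁆ = χ x • vacuum χ := by
  have h1 : ⁅(x : L), vacuum χ⁆ = InducedModule.proj χ
      ((1 * envIncl R P (UniversalEnvelopingAlgebra.ι R x)) ⊗ₜ[R] (CharModule.val χ).symm 1) := by
    rw [lie_eq_env_smul, env_smul_vacuum, envIncl, UniversalEnvelopingAlgebra.lift_ι_apply, one_mul]
    rfl
  have h2 : χ x • vacuum χ = InducedModule.proj χ
      (1 ⊗ₜ[R] (envAct R P (CharModule χ) (UniversalEnvelopingAlgebra.ι R x)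
        ((CharModule.val χ).symm 1))) := by
    rw [envAct_charModule, UniversalEnvelopingAlgebra.lift_ι_apply, TensorProduct.tmul_smul]
    rfl
  rw [h1, h2]
  exact (Submodule.Quotient.eq _).2 (Submodule.subset_span ⟨1, _, _, rfl⟩)

/-- A submodule of an induced module that contains the generator and is stable under the Lie
algebra is everything. -/
lemma eq_top_of_vacuum_mem (S : Submodule R (InducedModule R P (CharModule χ)))
    (h0 : vacuum χ ∈ S) (hS : ∀ x : L, ∀ m ∈ S, ⁅x, m⁆ ∈ S) : S = ⊤ := by
  have key : ∀ u : UniversalEnvelopingAlgebra R L, ∀ m ∈ S, u • m ∈ S := by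
    intro u
    have hu : u ∈ Algebra.adjoin R (Set.range (UniversalEnvelopingAlgebra.ι R (L := L))) := by
      rw [adjoin_range_envι]; trivial
    induction hu using Algebra.adjoin_induction with
    | mem x hx =>
      obtain ⟨y, rfl⟩ := hx
      exact hS y
    | algebraMap r =>
      intro m hm
      rw [algebraMap_smul]
      exact S.smul_mem _ hm
    | add x y _ _ hx hy =>
      intro m hm
      rw [add_smul]
      exact S.add_mem (hx m hm) (hy m hm)
    | mul x y _ _ hx hy =>
      intro m hm
      rw [mul_smul]
      exact hx _ (hy m hm)
  rw [eq_top_iff]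
  intro m _
  obtain ⟨u, rfl⟩ := exists_env_smul_vacuum m
  exact key u _ h0

/-- Universal property of a module induced from a character. -/
lemma exists_inducedModule_lift {N : Type*} [AddCommGroup N] [Module R N]
    (ρ : L →ₗ⁅R⁆ Module.End R N) (v : N) (hv : ∀ x : P, ρ x v = χ x • v) :
    ∃ F : InducedModule R P (CharModule χ) →ₗ[R] N,
      F (vacuum χ) = v ∧ ∀ (x : L) (m), F ⁅x, m⁆ = ρ x (F m) := by
  let act := UniversalEnvelopingAlgebra.lift R ρ
  have hact : ∀ a : UniversalEnvelopingAlgebra R P,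
      act (envIncl R P a) v = (UniversalEnvelopingAlgebra.lift R χ a : R) • v := by
    intro a
    have ha : a ∈ Algebra.adjoin R (Set.range (UniversalEnvelopingAlgebra.ι R (L := P))) := by
      rw [adjoin_range_envι]; trivial
    induction ha using Algebra.adjoin_induction with
    | mem x hx =>
      obtain ⟨y, rfl⟩ := hx
      rw [envIncl, UniversalEnvelopingAlgebra.lift_ι_apply,
        UniversalEnvelopingAlgebra.lift_ι_apply]
      change act (UniversalEnvelopingAlgebra.ι R (y : L)) v = _
      rw [UniversalEnvelopingAlgebra.lift_ι_apply, hv]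
    | algebraMap r => simp
    | add x y _ _ hx hy => simp [hx, hy, add_smul]
    | mul x y _ _ hx hy =>
      rw [map_mul, map_mul, Module.End.mul_apply, hy, map_smul, hx, map_mul, smul_smul, mul_comm]
  let B : UniversalEnvelopingAlgebra R L ⊗[R] CharModule χ →ₗ[R] N :=
    TensorProduct.lift (LinearMap.mk₂ R (fun u c => CharModule.val χ c • act u v)
      (fun u w c => by rw [map_add, LinearMap.add_apply, smul_add])
      (fun r u c => by rw [map_smul, LinearMap.smul_apply, smul_comm])
      (fun u c d => by rw [map_add, add_smul])
      (fun r u c => by rw [map_smul, smul_assoc]))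
  have hB : ∀ u c, B (u ⊗ₜ c) = CharModule.val χ c • act u v := fun u c => rfl
  have hBsmul : ∀ u t, B (u • t) = act u (B t) := by
    intro u t
    induction t using TensorProduct.induction_on with
    | zero => simp
    | tmul w c =>
      rw [TensorProduct.smul_tmul', smul_eq_mul, hB, hB, map_mul, map_smul]; rfl
    | add s t hs ht => rw [smul_add, map_add, map_add, map_add, hs, ht]
  -- `hact` kills the balancing generators, and `hBsmul` extends this to the U(L)-submodule they
  -- generate.
  have hker : ∀ t ∈ balancedSubmodule R P (CharModule χ), B t = 0 := by
    intro t ht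
    induction ht using Submodule.span_induction with
    | mem x hx =>
      obtain ⟨u, a, c, rfl⟩ := hx
      rw [map_sub, hB, hB, envAct_charModule, map_mul, Module.End.mul_apply, hact, map_smul,
        sub_eq_zero, smul_smul, map_smul, smul_eq_mul, mul_comm]
    | zero => exact map_zero _
    | add x y _ _ hx hy => rw [map_add, hx, hy, add_zero]
    | smul u x _ hx => rw [hBsmul, hx, map_zero]
  let F : InducedModule R P (CharModule χ) →ₗ[R] N :=
    ((balancedSubmodule R P (CharModule χ)).restrictScalars R).liftQ B hker ∘ₗ
      (Submodule.Quotient.restrictScalarsEquiv R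
        (balancedSubmodule R P (CharModule χ))).symm.toLinearMap
  have hF : ∀ t, F (InducedModule.proj χ t) = B t := fun t => rfl
  refine ⟨F, ?_, ?_⟩
  · rw [vacuum, hF, hB, LinearEquiv.apply_symm_apply, map_one, Module.End.one_apply, one_smul]
  · intro x m
    obtain ⟨t, rfl⟩ := InducedModule.proj_surjective m
    rw [lie_eq_env_smul, ← map_smul, hF, hF, hBsmul, UniversalEnvelopingAlgebra.lift_ι_apply]

open MvPolynomial in
/-- If commuting elements `Y i` span a complement of `P`, then the monomials in the `Y i`, applied
to the generator, span the module induced from a character of `P`. -/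
lemma exists_mvPolynomial_surjective {ι : Type*} [Fintype ι] (Y : ι → L)
    (hY : ∀ i j, ⁅Y i, Y j⁆ = 0) (c : L → ι → R) (hc : ∀ x, x - ∑ i, c x i • Y i ∈ P) :
    ∃ φ : MvPolynomial ι R →ₗ[R] InducedModule R P (CharModule χ),
      φ 1 = vacuum χ ∧ (∀ i f, φ (X i * f) = ⁅Y i, φ f⁆) ∧ Function.Surjective φ := by
  let T : ι → Module.End R (InducedModule R P (CharModule χ)) :=
    fun i => LieModule.toEnd R L (InducedModule R P (CharModule χ)) (Y i)
  have hT : ∀ a ∈ Set.range T, ∀ b ∈ Set.range T, a * b = b * a := by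
    rintro _ ⟨i, rfl⟩ _ ⟨j, rfl⟩
    refine LinearMap.ext fun m => ?_
    change ⁅Y i, ⁅Y j, m⁆⁆ = ⁅Y j, ⁅Y i, m⁆⁆
    rw [leibniz_lie, hY, zero_lie, zero_add]
  -- Polynomials can only be evaluated in a commutative ring, so evaluation takes place in the
  -- subalgebra generated by the commuting operators.
  have := Algebra.isMulCommutative_adjoin R hT
  let _ : CommRing (Algebra.adjoin R (Set.range T)) :=
    { (inferInstance : Ring (Algebra.adjoin R (Set.range T))) with mul_comm := mul_comm' }
  let U : ι → Algebra.adjoin R (Set.range T) := fun i => ⟨T i, Algebra.subset_adjoin ⟨i, rfl⟩⟩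
  let ev : MvPolynomial ι R →ₐ[R] Algebra.adjoin R (Set.range T) :=
    aeval U
  let φ : MvPolynomial ι R →ₗ[R] InducedModule R P (CharModule χ) :=
    (LinearMap.applyₗ (vacuum χ)) ∘ₗ
      ((Algebra.adjoin R (Set.range T)).val.comp ev).toLinearMap
  have h1 : φ 1 = vacuum χ := by
    change ((ev 1 : Algebra.adjoin R (Set.range T)) : Module.End R _) (vacuum χ) = _
    rw [map_one]; rfl
  have hX : ∀ i f, φ (X i * f) = ⁅Y i, φ f⁆ := by
    intro i f
    change ((ev (X i * f) : Algebra.adjoin R (Set.range T)) : Module.End R _) (vacuum χ) = _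
    rw [map_mul, aeval_X]; rfl
  refine ⟨φ, h1, hX, ?_⟩
  have hmem : ∀ i, ∀ m ∈ LinearMap.range φ, ⁅Y i, m⁆ ∈ LinearMap.range φ := by
    rintro i _ ⟨f, rfl⟩
    exact ⟨X i * f, hX i f⟩
  have hall : ∀ (f : MvPolynomial ι R), (∀ p : P, ⁅(p : L), φ f⁆ ∈ LinearMap.range φ) →
      ∀ x : L, ⁅x, φ f⁆ ∈ LinearMap.range φ := by
    intro f hf x
    have : x = ∑ i, c x i • Y i + (x - ∑ i, c x i • Y i) := by abel
    rw [this, add_lie]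
    refine Submodule.add_mem _ ?_ (hf ⟨_, hc x⟩)
    rw [sum_lie]
    refine Submodule.sum_mem _ fun i _ => ?_
    rw [smul_lie]
    exact Submodule.smul_mem _ _ (hmem i _ ⟨f, rfl⟩)
  have hP : ∀ (f : MvPolynomial ι R) (p : P), ⁅(p : L), φ f⁆ ∈ LinearMap.range φ := by
    intro f
    induction f using MvPolynomial.induction_on with
    | C r =>
      intro p
      rw [← mul_one (C r), ← smul_eq_C_mul, map_smul, h1, lie_smul, lie_vacuum]
      refine Submodule.smul_mem _ _ (Submodule.smul_mem _ _ ⟨1, h1⟩)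
    | add f g hf hg =>
      intro p
      rw [map_add, lie_add]
      exact Submodule.add_mem _ (hf p) (hg p)
    | mul_X f i hf =>
      -- Here p · Y_i m = [p, Y_i] m + Y_i (p m). The bracket [p, Y_i] can be any element of L,
      -- which is why the induction needs `hall`, not only the statement for P.
      intro p
      rw [mul_comm, hX, leibniz_lie]
      exact Submodule.add_mem _ (hall f hf _) (hmem i _ (hf p))
  have := eq_top_of_vacuum_mem (LinearMap.range φ) ⟨1, h1⟩
    (by rintro x _ ⟨f, rfl⟩; exact hall f (hP f) x)
  exact LinearMap.range_eq_top.1 this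

end Induced

/-! ### Conformal differential operators on a polynomial ring -/

section Weyl

open MvPolynomial Matrix

variable {ι : Type*} [Fintype ι]

/-- The linear form with coefficients `u`. -/
def lin (u : ι → ℂ) : MvPolynomial ι ℂ := ∑ i, C (u i) * X i

/-- The constant coefficient vector field with coefficients `w`. -/
def dd (w : ι → ℂ) : Derivation ℂ (MvPolynomial ι ℂ) (MvPolynomial ι ℂ) :=
  mkDerivation ℂ fun i => C (w i)

/-- The linear vector field with matrix `A`. -/
def rot (A : Matrix ι ι ℂ) : Derivation ℂ (MvPolynomial ι ℂ) (MvPolynomial ι ℂ) :=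
  mkDerivation ℂ fun j => lin fun i => A i j

/-- The Euler vector field. -/
def eul : Derivation ℂ (MvPolynomial ι ℂ) (MvPolynomial ι ℂ) := mkDerivation ℂ X

/-- Half of the Laplace operator of the form with coefficients `ε`. -/
def lap (ε : ι → ℂ) : MvPolynomial ι ℂ →ₗ[ℂ] MvPolynomial ι ℂ :=
  ∑ k, (ε k / 2) • (pderiv k).toLinearMap ∘ₗ (pderiv k).toLinearMap

lemma lap_apply (ε : ι → ℂ) (f : MvPolynomial ι ℂ) :
    lap ε f = ∑ k, C (ε k / 2) * pderiv k (pderiv k f) := by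
  simp [lap, smul_eq_C_mul]

omit [Fintype ι] in
lemma map_C_mul' (T : MvPolynomial ι ℂ →ₗ[ℂ] MvPolynomial ι ℂ) (c : ℂ) (f : MvPolynomial ι ℂ) :
    T (C c * f) = C c * T f := by
  rw [← smul_eq_C_mul, map_smul, smul_eq_C_mul]

omit [Fintype ι] in
lemma derivation_C_mul' (D : Derivation ℂ (MvPolynomial ι ℂ) (MvPolynomial ι ℂ)) (c : ℂ)
    (f : MvPolynomial ι ℂ) : D (C c * f) = C c * D f :=
  map_C_mul' D.toLinearMap c f

omit [Fintype ι] in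
lemma derivation_sum_apply {κ : Type*} (s : Finset κ)
    (D : κ → Derivation ℂ (MvPolynomial ι ℂ) (MvPolynomial ι ℂ)) (f : MvPolynomial ι ℂ) :
    (∑ k ∈ s, D k) f = ∑ k ∈ s, D k f := by
  classical
  induction s using Finset.induction_on with
  | empty => simp
  | insert a s ha ih => rw [Finset.sum_insert ha, Finset.sum_insert ha, Derivation.add_apply, ih]

lemma lin_add (u v : ι → ℂ) : lin (u + v) = lin u + lin v := by
  simp [lin, add_mul, Finset.sum_add_distrib]

lemma lin_smul (c : ℂ) (u : ι → ℂ) : lin (c • u) = C c * lin u := by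
  simp [lin, Finset.mul_sum, mul_assoc]

lemma lin_sub (u v : ι → ℂ) : lin (u - v) = lin u - lin v := by
  simp [lin, sub_mul, Finset.sum_sub_distrib]

lemma derivation_lin (D : Derivation ℂ (MvPolynomial ι ℂ) (MvPolynomial ι ℂ)) (u : ι → ℂ) :
    D (lin u) = ∑ i, C (u i) * D (X i) := by
  simp only [lin, map_sum, derivation_C_mul']

/-! ### Commutation relations of constant, linear and Euler vector fields -/

omit [Fintype ι] in
@[simp] lemma dd_X (w : ι → ℂ) (i : ι) : dd w (X i) = C (w i) := mkDerivation_X _ _ _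

@[simp] lemma rot_X (A : Matrix ι ι ℂ) (j : ι) : rot A (X j) = lin fun i => A i j :=
  mkDerivation_X _ _ _

omit [Fintype ι] in
@[simp] lemma eul_X (i : ι) : eul (X i : MvPolynomial ι ℂ) = X i := mkDerivation_X _ _ _

@[simp] lemma dd_lin (w u : ι → ℂ) : dd w (lin u) = C (w ⬝ᵥ u) := by
  simp [derivation_lin, dotProduct, mul_comm]

@[simp] lemma eul_lin (u : ι → ℂ) : eul (lin u) = lin u := by
  rw [derivation_lin]; simp only [eul_X, lin]

@[simp] lemma rot_lin (A : Matrix ι ι ℂ) (u : ι → ℂ) : rot A (lin u) = lin (A *ᵥ u) := by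
  rw [derivation_lin]
  simp only [rot_X, lin, mulVec, dotProduct, map_sum, Finset.mul_sum, Finset.sum_mul, map_mul]
  rw [Finset.sum_comm]
  exact Finset.sum_congr rfl fun i _ => Finset.sum_congr rfl fun j _ => by ring

-- The commutator of two derivations is again a derivation, so the relation only has to be checked
-- on the variables.
omit [Fintype ι] in
lemma derivation_comm {D₁ D₂ D₃ : Derivation ℂ (MvPolynomial ι ℂ) (MvPolynomial ι ℂ)}
    (h : ∀ i, D₁ (D₂ (X i)) = D₂ (D₁ (X i)) + D₃ (X i)) (f : MvPolynomial ι ℂ) :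
    D₁ (D₂ f) = D₂ (D₁ f) + D₃ f := by
  have : ⁅D₁, D₂⁆ = D₃ := derivation_ext fun i => by
    rw [Derivation.commutator_apply, h, add_sub_cancel_left]
  rw [← this, Derivation.commutator_apply, add_sub_cancel]

omit [Fintype ι] in
lemma dd_comm (w w' : ι → ℂ) (f : MvPolynomial ι ℂ) : dd w (dd w' f) = dd w' (dd w f) := by
  have := derivation_comm (D₁ := dd w) (D₂ := dd w') (D₃ := 0) (by simp [derivation_C]) f
  simpa using this

omit [Fintype ι] in
lemma dd_eul (w : ι → ℂ) (f : MvPolynomial ι ℂ) : dd w (eul f) = eul (dd w f) + dd w f :=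
  derivation_comm (by simp [derivation_C]) f

lemma rot_eul (A : Matrix ι ι ℂ) (f : MvPolynomial ι ℂ) : rot A (eul f) = eul (rot A f) := by
  have := derivation_comm (D₁ := rot A) (D₂ := eul) (D₃ := 0) (by simp) f
  simpa using this

lemma dd_rot (w : ι → ℂ) (A : Matrix ι ι ℂ) (f : MvPolynomial ι ℂ) :
    dd w (rot A f) = rot A (dd w f) + dd (w ᵥ* A) f :=
  derivation_comm (by simp [derivation_C]; intro i; rfl) f

lemma rot_rot (A B : Matrix ι ι ℂ) (f : MvPolynomial ι ℂ) :
    rot A (rot B f) = rot B (rot A f) + rot (A * B - B * A) f :=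
  derivation_comm (by
    intro i
    have h : (fun j => (A * B - B * A) j i) = A *ᵥ (fun j => B j i) - B *ᵥ (fun j => A j i) := by
      ext j; simp [mul_apply, mulVec, dotProduct]
    rw [rot_X, rot_X, rot_X, rot_lin, rot_lin, h, lin_sub, add_sub_cancel]) f

omit [Fintype ι] in
lemma pderiv_eq_dd [DecidableEq ι] (k : ι) :
    (pderiv k : Derivation ℂ (MvPolynomial ι ℂ) (MvPolynomial ι ℂ)) = dd (Pi.single k 1) := by
  apply derivation_ext
  intro i
  rw [pderiv_X, dd_X]
  by_cases h : i = k
  · subst h; simp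
  · simp [h]

omit [Fintype ι] in
lemma dd_add (w w' : ι → ℂ) (f : MvPolynomial ι ℂ) : dd (w + w') f = dd w f + dd w' f := by
  have : dd (w + w') = dd w + dd w' := derivation_ext fun i => by simp
  simp [this]

omit [Fintype ι] in
lemma dd_smul (c : ℂ) (w : ι → ℂ) (f : MvPolynomial ι ℂ) : dd (c • w) f = C c * dd w f := by
  have : dd (c • w) = c • dd w := derivation_ext fun i => by simp [smul_eq_C_mul]
  simp [this, smul_eq_C_mul]

omit [Fintype ι] in
lemma dd_sub (w w' : ι → ℂ) (f : MvPolynomial ι ℂ) : dd (w - w') f = dd w f - dd w' f := by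
  have : dd (w - w') = dd w - dd w' := derivation_ext fun i => by simp
  simp [this]

lemma rot_add (A B : Matrix ι ι ℂ) (f : MvPolynomial ι ℂ) :
    rot (A + B) f = rot A f + rot B f := by
  have : rot (A + B) = rot A + rot B := derivation_ext fun i => by
    simp only [rot_X, Derivation.add_apply, ← lin_add]; rfl
  simp [this]

lemma rot_sub (A B : Matrix ι ι ℂ) (f : MvPolynomial ι ℂ) :
    rot (A - B) f = rot A f - rot B f := by
  have : rot (A - B) = rot A - rot B := derivation_ext fun i => by
    simp only [rot_X, Derivation.sub_apply, ← lin_sub]; rfl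
  simp [this]

lemma rot_smul (c : ℂ) (A : Matrix ι ι ℂ) (f : MvPolynomial ι ℂ) :
    rot (c • A) f = C c * rot A f := by
  have : rot (c • A) = c • rot A := derivation_ext fun i => by
    simp only [rot_X, Derivation.smul_apply, smul_eq_C_mul, ← lin_smul]; rfl
  simp [this, smul_eq_C_mul]

/-- These rank-one rotations are the terms that brackets of 𝔫₋ with 𝔫₊ contribute to the
so(n)-block. -/
lemma rot_vecMulVec (u w : ι → ℂ) (f : MvPolynomial ι ℂ) :
    rot (vecMulVec u w) f = lin u * dd w f := by
  have : rot (vecMulVec u w) = lin u • dd w := derivation_ext fun i => by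
    have h : (fun j => vecMulVec u w j i) = w i • u := by ext j; simp [vecMulVec, mul_comm]
    rw [rot_X, h, lin_smul]; simp [mul_comm]
  simp [this]

lemma dd_eq_sum (w : ι → ℂ) (f : MvPolynomial ι ℂ) : dd w f = ∑ k, C (w k) * pderiv k f := by
  classical
  have : dd w = ∑ k, w k • pderiv k := derivation_ext fun i => by
    rw [derivation_sum_apply]
    simp [pderiv_X, Pi.single_apply, smul_eq_C_mul]
  rw [this, derivation_sum_apply]
  simp [smul_eq_C_mul]

/-! ### Commutation relations of the Laplacian -/

lemma lap_dd (ε w : ι → ℂ) (f : MvPolynomial ι ℂ) : lap ε (dd w f) = dd w (lap ε f) := by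
  classical
  simp only [lap_apply, map_sum, derivation_C_mul', pderiv_eq_dd]
  refine Finset.sum_congr rfl fun k _ => ?_
  rw [dd_comm _ w, dd_comm _ w]

lemma lap_eul (ε : ι → ℂ) (f : MvPolynomial ι ℂ) :
    lap ε (eul f) = eul (lap ε f) + 2 * lap ε f := by
  classical
  simp only [lap_apply, map_sum, derivation_C_mul', pderiv_eq_dd, dd_eul, map_add,
    Finset.mul_sum, ← Finset.sum_add_distrib]
  exact Finset.sum_congr rfl fun k _ => by ring

/-- The factor 1/2 in `lap` is what makes the correction exactly one first derivative. -/
lemma lap_lin (ε u : ι → ℂ) (f : MvPolynomial ι ℂ) :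
    lap ε (lin u * f) = lin u * lap ε f + dd (ε * u) f := by
  classical
  rw [dd_eq_sum]
  simp only [lap_apply, pderiv_eq_dd, Derivation.leibniz, smul_eq_mul, dd_lin, map_add, Finset.mul_sum, ← Finset.sum_add_distrib]
  refine Finset.sum_congr rfl fun k _ => ?_
  have h : (C (ε k / 2) : MvPolynomial ι ℂ) * 2 = C (ε k) := by
    rw [← map_ofNat C 2, ← map_mul, div_mul_cancel₀ _ two_ne_zero]
  simp only [single_one_dotProduct, Pi.mul_apply, map_mul, derivation_C]
  linear_combination (C (u k) * dd (Pi.single k 1) f) * h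

/-- Skewness of A makes the Laplacian rotation invariant: the correction term contracts the
symmetric ∂_k ∂_j with the antisymmetric ε_k A_kj, so it equals its own negative. -/
lemma lap_rot {ε : ι → ℂ} {A : Matrix ι ι ℂ} (hA : ∀ i j, ε i * A i j = -(ε j * A j i))
    (f : MvPolynomial ι ℂ) : lap ε (rot A f) = rot A (lap ε f) := by
  classical
  have key : ∑ k, C (ε k) * pderiv k (dd (A k) f) = 0 := by
    have h1 : ∑ k, C (ε k) * pderiv k (dd (A k) f) =
        ∑ k, ∑ j, C (ε k * A k j) * pderiv k (pderiv j f) := by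
      refine Finset.sum_congr rfl fun k _ => ?_
      rw [dd_eq_sum, map_sum, Finset.mul_sum]
      refine Finset.sum_congr rfl fun j _ => ?_
      rw [pderiv_C_mul, map_mul, mul_assoc]
    have h2 : ∑ k, C (ε k) * pderiv k (dd (A k) f) = -∑ k, C (ε k) * pderiv k (dd (A k) f) := by
      conv_lhs => rw [h1, Finset.sum_comm]
      rw [h1, ← Finset.sum_neg_distrib]
      refine Finset.sum_congr rfl fun k _ => ?_
      rw [← Finset.sum_neg_distrib]
      refine Finset.sum_congr rfl fun j _ => ?_
      rw [hA j k, pderiv_eq_dd, pderiv_eq_dd, dd_comm, map_neg, neg_mul]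
    exact self_eq_neg.1 h2
  have h3 : lap ε (rot A f) = rot A (lap ε f) + ∑ k, C (ε k) * pderiv k (dd (A k) f) := by
    simp only [lap_apply, map_sum, derivation_C_mul', pderiv_eq_dd, ← Finset.sum_add_distrib]
    refine Finset.sum_congr rfl fun k _ => ?_
    have hk : (Pi.single k 1 : ι → ℂ) ᵥ* A = A k := by simp; rfl
    rw [dd_rot, map_add, dd_rot, hk, dd_comm (A k)]
    have h : (C (ε k / 2) : MvPolynomial ι ℂ) * 2 = C (ε k) := by
      rw [← map_ofNat C 2, ← map_mul, div_mul_cancel₀ _ two_ne_zero]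
    rw [← h]
    ring
  rw [h3, key, add_zero]

/-- The operator attached to the element of `so(n+2)` with grading element coefficient `a`,
`𝔫₋`-part `u`, `𝔫₊`-part `w` and `so(n)`-part `A`. -/
def conf (ε : ι → ℂ) (lam a : ℂ) (u w : ι → ℂ) (A : Matrix ι ι ℂ) :
    MvPolynomial ι ℂ →ₗ[ℂ] MvPolynomial ι ℂ :=
  LinearMap.mulLeft ℂ (lin u) + a • (lam • LinearMap.id - eul.toLinearMap) + (rot A).toLinearMap
    + (lam • LinearMap.id - eul.toLinearMap) ∘ₗ (dd w).toLinearMap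
    + LinearMap.mulLeft ℂ (lin (ε * w)) ∘ₗ lap ε

lemma conf_apply (ε : ι → ℂ) (lam a : ℂ) (u w : ι → ℂ) (A : Matrix ι ι ℂ) (f : MvPolynomial ι ℂ) :
    conf ε lam a u w A f = lin u * f + C a * (C lam * f - eul f) + rot A f
      + (C lam * dd w f - eul (dd w f)) + lin (ε * w) * lap ε f := by
  simp [conf, smul_eq_C_mul]

lemma conf_add (ε : ι → ℂ) (lam a a' : ℂ) (u u' w w' : ι → ℂ) (A A' : Matrix ι ι ℂ) :
    conf ε lam (a + a') (u + u') (w + w') (A + A') =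
      conf ε lam a u w A + conf ε lam a' u' w' A' := by
  refine LinearMap.ext fun f => ?_
  simp only [conf_apply, LinearMap.add_apply, lin_add, dd_add, rot_add, mul_add, map_add]
  ring

lemma conf_smul (ε : ι → ℂ) (lam c a : ℂ) (u w : ι → ℂ) (A : Matrix ι ι ℂ) :
    conf ε lam (c * a) (c • u) (c • w) (c • A) = c • conf ε lam a u w A := by
  refine LinearMap.ext fun f => ?_
  simp only [conf_apply, LinearMap.smul_apply, lin_smul, dd_smul, rot_smul, mul_smul_comm,
    smul_eq_C_mul, map_mul, derivation_C_mul']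
  ring

/-- The isomorphism of 𝔫₊ with 𝔫₋ given by ε is so(n)-equivariant; the sign comes from passing from
the column action to the row action. -/
lemma mulVec_eps_mul {ε : ι → ℂ} (hε : ∀ i, ε i * ε i = 1) {A : Matrix ι ι ℂ}
    (hA : ∀ i j, ε i * A i j = -(ε j * A j i)) (w : ι → ℂ) :
    A *ᵥ (ε * w) = -(ε * (w ᵥ* A)) := by
  ext i
  simp only [mulVec, vecMul, dotProduct, Pi.mul_apply, Pi.neg_apply, Finset.mul_sum,
    ← Finset.sum_neg_distrib]
  refine Finset.sum_congr rfl fun j _ => ?_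
  linear_combination (-A i j * ε j * w j) * hε i + ε i * ε j * w j * hA i j
    - ε i * w j * A j i * hε j

/-- The arguments on the left are the blocks of a matrix commutator in so(n+2), so this is the
representation property. Both sides are normally ordered with the relations above, moving every
derivation to the right of the multiplications. -/
lemma conf_commutator {ε : ι → ℂ} (hε : ∀ i, ε i * ε i = 1) (lam a a' : ℂ) (u u' w w' : ι → ℂ)
    {A A' : Matrix ι ι ℂ} (hA : ∀ i j, ε i * A i j = -(ε j * A j i))
    (hA' : ∀ i j, ε i * A' i j = -(ε j * A' j i)) (f : MvPolynomial ι ℂ) :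
    conf ε lam (w ⬝ᵥ u' - w' ⬝ᵥ u) (a' • u + A *ᵥ u' - (a • u' + A' *ᵥ u))
      (a • w' + w ᵥ* A' - (a' • w + w' ᵥ* A))
      (vecMulVec u w' + A * A' + vecMulVec (ε * w) (ε * u')
        - (vecMulVec u' w + A' * A + vecMulVec (ε * w') (ε * u))) f
    = conf ε lam a u w A (conf ε lam a' u' w' A' f)
      - conf ε lam a' u' w' A' (conf ε lam a u w A f) := by
  have hεε : ∀ v : ι → ℂ, ε * (ε * v) = v := fun v => by
    ext i; simp [← mul_assoc, hε]
  have h1 : lin (ε * (a • w' + w ᵥ* A' - (a' • w + w' ᵥ* A))) =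
      C a * lin (ε * w') - lin (A' *ᵥ (ε * w)) - C a' * lin (ε * w) + lin (A *ᵥ (ε * w')) := by
    rw [mulVec_eps_mul hε hA, mulVec_eps_mul hε hA', ← lin_smul, ← lin_smul, ← lin_sub, ← lin_sub,
      ← lin_add]
    congr 1
    ext i
    simp
    ring
  have hd : ∀ v v' : ι → ℂ, v ⬝ᵥ (ε * v') = v' ⬝ᵥ (ε * v) := fun v v' => by
    simp only [dotProduct, Pi.mul_apply]
    exact Finset.sum_congr rfl fun i _ => by ring
  have hrot : rot (A * A' - A' * A) f = rot (A * A') f - rot (A' * A) f := rot_sub _ _ _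
  -- As a rewrite rule this relation would loop, so it is kept aside for the final linear
  -- combination.
  have hr := rot_rot A A' f
  rw [hrot] at hr
  simp only [conf_apply, h1]
  simp only [map_add, map_sub, Derivation.leibniz, smul_eq_mul, derivation_C, dd_lin, eul_lin,
    rot_lin, lap_lin, hεε, map_C_mul', lap_dd, lap_eul, lap_rot hA, lap_rot hA', dd_eul, dd_rot, rot_eul,
    lin_sub, lin_add, lin_smul, dd_sub, dd_add, dd_smul, rot_sub, rot_add, rot_vecMulVec, map_zero, hd w w', dd_comm w w']
  linear_combination -hr

end Weyl

/-! ### The polynomial model of the scalar generalized Verma modules -/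

section Model

open MvPolynomial Matrix

variable {n p : ℕ}

/-- The index of the basis vector `e_{i+1}`. -/
def mid (i : Fin n) : Fin (n + 2) := i.succ.castSucc

/-- The sign `ε_{i+1}`. -/
def eps (n p : ℕ) (i : Fin n) : ℂ := if (i : ℕ) + 1 < p then 1 else -1

lemma eps_mul_self (i : Fin n) : eps n p i * eps n p i = 1 := by
  unfold eps; split_ifs <;> norm_num

lemma mid_ne_zero (i : Fin n) : mid i ≠ 0 := by simp [mid, Fin.ext_iff]

lemma mid_ne_last (i : Fin n) : mid i ≠ Fin.last (n + 1) := by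
  have := i.2
  simp [mid, Fin.ext_iff]
  omega

lemma mid_injective : Function.Injective (mid (n := n)) := fun i j h => by
  simpa [mid] using h

lemma index_cases (k : Fin (n + 2)) : k = 0 ∨ (∃ i : Fin n, k = mid i) ∨ k = Fin.last (n + 1) := by
  induction k using Fin.lastCases with
  | last => exact Or.inr (Or.inr rfl)
  | cast k =>
    induction k using Fin.cases with
    | zero => exact Or.inl rfl
    | succ i => exact Or.inr (Or.inl ⟨i, rfl⟩)

lemma sum_index (f : Fin (n + 2) → ℂ) :
    ∑ k, f k = f 0 + ∑ i, f (mid i) + f (Fin.last (n + 1)) := by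
  rw [Fin.sum_univ_castSucc, Fin.sum_univ_succ]; rfl

lemma zero_ne_last : (0 : Fin (n + 2)) ≠ Fin.last (n + 1) := (Fin.last_pos).ne

@[simp] lemma gram_zero_zero : gram n p 0 0 = 0 := by
  simp [gram]

@[simp] lemma gram_zero_last : gram n p 0 (Fin.last (n + 1)) = 1 := by simp [gram]

@[simp] lemma gram_last_zero : gram n p (Fin.last (n + 1)) 0 = 1 := by simp [gram]

@[simp] lemma gram_last_last : gram n p (Fin.last (n + 1)) (Fin.last (n + 1)) = 0 := by
  simp [gram]

@[simp] lemma gram_zero_mid (i : Fin n) : gram n p 0 (mid i) = 0 := by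
  simp [gram, mid_ne_last, (mid_ne_zero i).symm]

@[simp] lemma gram_mid_zero (i : Fin n) : gram n p (mid i) 0 = 0 := by
  simp [gram, mid_ne_last, mid_ne_zero i]

@[simp] lemma gram_last_mid (i : Fin n) : gram n p (Fin.last (n + 1)) (mid i) = 0 := by
  simp [gram, mid_ne_zero]

@[simp] lemma gram_mid_last (i : Fin n) : gram n p (mid i) (Fin.last (n + 1)) = 0 := by
  simp [gram, mid_ne_zero, mid_ne_last]

@[simp] lemma gram_mid_mid (i j : Fin n) :
    gram n p (mid i) (mid j) = if i = j then eps n p i else 0 := by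
  simp [gram, mid_ne_zero, mid_ne_last, mid_injective.eq_iff, eps]
  rfl

lemma mem_soG_iff (X : Matrix (Fin (n + 2)) (Fin (n + 2)) ℂ) :
    X ∈ soG n p ↔ ∀ k l, ∑ s, X s k * gram n p s l = -∑ s, gram n p k s * X s l := by
  rw [mem_skewAdjointMatricesLieSubalgebra, mem_skewAdjointMatricesSubmodule]
  change Xᵀ * gram n p = gram n p * -X ↔ _
  rw [← Matrix.ext_iff]
  simp [mul_apply]

/-! ### Entries of a matrix in so(n+2) forced by skewness -/

section Entries

variable {X : Matrix (Fin (n + 2)) (Fin (n + 2)) ℂ}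

lemma soG_last_zero (hX : X ∈ soG n p) : X (Fin.last (n + 1)) 0 = 0 := by
  have := (mem_soG_iff X).1 hX 0 0
  simp [sum_index] at this
  exact self_eq_neg.1 this

lemma soG_zero_last (hX : X ∈ soG n p) : X 0 (Fin.last (n + 1)) = 0 := by
  have := (mem_soG_iff X).1 hX (Fin.last (n + 1)) (Fin.last (n + 1))
  simp [sum_index] at this
  exact self_eq_neg.1 this

lemma soG_last_last (hX : X ∈ soG n p) : X (Fin.last (n + 1)) (Fin.last (n + 1)) = -X 0 0 := by
  have := (mem_soG_iff X).1 hX 0 (Fin.last (n + 1))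
  simp [sum_index] at this
  rw [this, neg_neg]

lemma soG_last_mid (hX : X ∈ soG n p) (i : Fin n) :
    X (Fin.last (n + 1)) (mid i) = -(eps n p i * X (mid i) 0) := by
  have := (mem_soG_iff X).1 hX 0 (mid i)
  simp [sum_index] at this
  rw [mul_comm, this, neg_neg]

lemma soG_mid_last (hX : X ∈ soG n p) (i : Fin n) :
    X (mid i) (Fin.last (n + 1)) = -(eps n p i * X 0 (mid i)) := by
  have := (mem_soG_iff X).1 hX (mid i) (Fin.last (n + 1))
  simp [sum_index] at this
  rw [this, mul_neg, neg_neg, ← mul_assoc, eps_mul_self, one_mul]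

lemma soG_mid_mid (hX : X ∈ soG n p) (i j : Fin n) :
    eps n p i * X (mid i) (mid j) = -(eps n p j * X (mid j) (mid i)) := by
  have := (mem_soG_iff X).1 hX (mid i) (mid j)
  simp [sum_index] at this
  rw [mul_comm (eps n p j), this, neg_neg]

end Entries

/-- The `𝔫₋`-part of a matrix: the middle of the first column. -/
def colPart (X : Matrix (Fin (n + 2)) (Fin (n + 2)) ℂ) : Fin n → ℂ := fun i => X (mid i) 0

/-- The `𝔫₊`-part of a matrix: the middle of the first row. -/
def rowPart (X : Matrix (Fin (n + 2)) (Fin (n + 2)) ℂ) : Fin n → ℂ := fun i => X 0 (mid i)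

/-- The middle block of a matrix. -/
def midPart (X : Matrix (Fin (n + 2)) (Fin (n + 2)) ℂ) : Matrix (Fin n) (Fin n) ℂ :=
  Matrix.of fun i j => X (mid i) (mid j)

section Products

variable {X Y : Matrix (Fin (n + 2)) (Fin (n + 2)) ℂ}

lemma mul_zero_zero (hX : X ∈ soG n p) : (X * Y) 0 0 = X 0 0 * Y 0 0 + rowPart X ⬝ᵥ colPart Y := by
  rw [mul_apply, sum_index, soG_zero_last hX, zero_mul, add_zero]; rfl

lemma colPart_mul (hY : Y ∈ soG n p) :
    colPart (X * Y) = Y 0 0 • colPart X + midPart X *ᵥ colPart Y := by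
  ext i
  rw [colPart, mul_apply, sum_index, soG_last_zero hY, mul_zero, add_zero, mul_comm]; rfl

lemma rowPart_mul (hX : X ∈ soG n p) :
    rowPart (X * Y) = X 0 0 • rowPart Y + rowPart X ᵥ* midPart Y := by
  ext i
  rw [rowPart, mul_apply, sum_index, soG_zero_last hX, zero_mul, add_zero]; rfl

/-- The three terms are the paths through e_0, the middle and e_{n+1}. Skewness rewrites the last as
a second rank-one matrix, whose two signs cancel. -/
lemma midPart_mul (hX : X ∈ soG n p) (hY : Y ∈ soG n p) :
    midPart (X * Y) = vecMulVec (colPart X) (rowPart Y) + midPart X * midPart Y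
      + vecMulVec (eps n p * rowPart X) (eps n p * colPart Y) := by
  ext i j
  rw [midPart, of_apply, mul_apply, sum_index, soG_mid_last hX, soG_last_mid hY, neg_mul_neg]; rfl

end Products

/-- The action of `g` on polynomials that realizes the scalar generalized Verma module. -/
def model (n p : ℕ) (lam : ℂ) : soG n p →ₗ⁅ℂ⁆ Module.End ℂ (MvPolynomial (Fin n) ℂ) where
  toFun X := conf (eps n p) lam (X.1 0 0) (colPart X.1) (rowPart X.1) (midPart X.1)
  map_add' X Y := conf_add _ _ _ _ _ _ _ _ _ _
  map_smul' c X := conf_smul _ _ c _ _ _ _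
  map_lie' := by
    intro X Y
    refine LinearMap.ext fun f => ?_
    refine Eq.trans ?_ (conf_commutator (A := midPart X.1) (A' := midPart Y.1) eps_mul_self lam (X.1 0 0) (Y.1 0 0) (colPart X.1)
      (colPart Y.1) (rowPart X.1) (rowPart Y.1) (soG_mid_mid X.2) (soG_mid_mid Y.2) f)
    have h0 : (⁅X, Y⁆ : soG n p).1 = X.1 * Y.1 - Y.1 * X.1 := rfl
    have h1 : (X.1 * Y.1 - Y.1 * X.1) 0 0 =
        rowPart X.1 ⬝ᵥ colPart Y.1 - rowPart Y.1 ⬝ᵥ colPart X.1 := by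
      rw [Matrix.sub_apply, mul_zero_zero X.2, mul_zero_zero Y.2]; ring
    have h2 : colPart (X.1 * Y.1 - Y.1 * X.1) = colPart (X.1 * Y.1) - colPart (Y.1 * X.1) := rfl
    have h3 : rowPart (X.1 * Y.1 - Y.1 * X.1) = rowPart (X.1 * Y.1) - rowPart (Y.1 * X.1) := rfl
    have h4 : midPart (X.1 * Y.1 - Y.1 * X.1) = midPart (X.1 * Y.1) - midPart (Y.1 * X.1) := rfl
    rw [h0, h1, h2, h3, h4, colPart_mul Y.2, colPart_mul X.2, rowPart_mul X.2, rowPart_mul Y.2,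
      midPart_mul X.2 Y.2, midPart_mul Y.2 X.2]

lemma model_apply (lam : ℂ) (X : soG n p) (f : MvPolynomial (Fin n) ℂ) :
    model n p lam X f =
      conf (eps n p) lam (X.1 0 0) (colPart X.1) (rowPart X.1) (midPart X.1) f := rfl

/-! ### The nilradical 𝔫₋ and the comparison with the Verma module -/

/-- The matrix of the root vector of `𝔫₋` that maps `e_0` to `e_{i+1}`. -/
def lowMatrix (n p : ℕ) (i : Fin n) : Matrix (Fin (n + 2)) (Fin (n + 2)) ℂ :=
  single (mid i) 0 1 - eps n p i • single (Fin.last (n + 1)) (mid i) 1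

lemma lowMatrix_mem (i : Fin n) : lowMatrix n p i ∈ soG n p := by
  rw [mem_soG_iff]
  intro k l
  rcases index_cases k with rfl | ⟨k, rfl⟩ | rfl <;>
  rcases index_cases l with rfl | ⟨l, rfl⟩ | rfl <;>
  simp [sum_index, lowMatrix, single_apply, mid_ne_zero, mid_ne_last, mid_injective.eq_iff,
    (mid_ne_zero _).symm, (mid_ne_last _).symm, zero_ne_last.symm]
  by_cases h : i = k
  · subst h; simp
  · simp [h, Ne.symm h]

/-- The root vector of `𝔫₋` that maps `e_0` to `e_{i+1}`. -/
def low (p : ℕ) (i : Fin n) : soG n p := ⟨lowMatrix n p i, lowMatrix_mem i⟩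

lemma soG_ext {X Y : soG n p} (h0 : X.1 0 0 = Y.1 0 0) (h1 : colPart X.1 = colPart Y.1)
    (h2 : rowPart X.1 = rowPart Y.1) (h3 : midPart X.1 = midPart Y.1) : X = Y := by
  have h1' := congrFun h1
  have h2' := congrFun h2
  have h3' := fun i j => congrFun (congrFun h3 i) j
  simp only [colPart, rowPart, midPart, of_apply] at h1' h2' h3'
  ext k l
  rcases index_cases k with rfl | ⟨k, rfl⟩ | rfl <;>
  rcases index_cases l with rfl | ⟨l, rfl⟩ | rfl
  · exact h0
  · exact h2' l
  · rw [soG_zero_last X.2, soG_zero_last Y.2]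
  · exact h1' k
  · exact h3' k l
  · rw [soG_mid_last X.2, soG_mid_last Y.2, h2']
  · rw [soG_last_zero X.2, soG_last_zero Y.2]
  · rw [soG_last_mid X.2, soG_last_mid Y.2, h1']
  · rw [soG_last_last X.2, soG_last_last Y.2, h0]

lemma low_zero_zero (i : Fin n) : (low p i).1 0 0 = 0 := by
  simp [low, lowMatrix, mid_ne_zero, zero_ne_last.symm]

lemma colPart_low (i : Fin n) : colPart (low p i).1 = Pi.single i 1 := by
  ext j
  by_cases h : i = j
  · subst h
    simp [low, lowMatrix, colPart, mid_ne_zero]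
  · simp [low, lowMatrix, colPart, mid_ne_zero, mid_injective.eq_iff, h, Ne.symm h]

lemma rowPart_low (i : Fin n) : rowPart (low p i).1 = 0 := by
  ext j
  simp [low, lowMatrix, rowPart, mid_ne_zero, zero_ne_last.symm]

lemma midPart_low (i : Fin n) : midPart (low p i).1 = 0 := by
  ext j k
  simp [low, lowMatrix, midPart, (mid_ne_zero _).symm, (mid_ne_last _).symm]

lemma lie_low_low (i j : Fin n) : ⁅low p i, low p j⁆ = 0 := by
  have h0 : (⁅low p i, low p j⁆ : soG n p).1 = (low p i).1 * (low p j).1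
    - (low p j).1 * (low p i).1 := rfl
  apply soG_ext
  · rw [h0, Matrix.sub_apply, mul_zero_zero (low p i).2, mul_zero_zero (low p j).2]
    simp [low_zero_zero, rowPart_low]
  · change colPart ((low p i).1 * (low p j).1)
      - colPart ((low p j).1 * (low p i).1) = 0
    rw [colPart_mul (low p j).2, colPart_mul (low p i).2]
    simp [low_zero_zero, midPart_low]
  · change rowPart ((low p i).1 * (low p j).1)
      - rowPart ((low p j).1 * (low p i).1) = 0
    rw [rowPart_mul (low p j).2, rowPart_mul (low p i).2]
    simp [low_zero_zero, midPart_low]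
  · change midPart ((low p i).1 * (low p j).1)
      - midPart ((low p j).1 * (low p i).1) = 0
    rw [midPart_mul (low p j).2 (low p i).2, midPart_mul (low p i).2 (low p j).2]
    simp [rowPart_low, midPart_low]

lemma model_low (lam : ℂ) (i : Fin n) (f : MvPolynomial (Fin n) ℂ) :
    model n p lam (low p i) f = X i * f := by
  have hl : lin (Pi.single i 1 : Fin n → ℂ) = X i := by
    simp [lin, Pi.single_apply]
  have hd : dd (0 : Fin n → ℂ) = 0 := derivation_ext fun j => by simp
  have hr : rot (0 : Matrix (Fin n) (Fin n) ℂ) = 0 := derivation_ext fun j => by simp [lin]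
  rw [model_apply, low_zero_zero, colPart_low, rowPart_low, midPart_low, conf_apply, hl, hd, hr]
  simp [lin]

lemma sub_sum_low_mem (X : soG n p) : X - ∑ i, colPart X.1 i • low p i ∈ parabolic n p := by
  intro k hk
  have hs : (X - ∑ i, colPart X.1 i • low p i).1 k 0 =
      X.1 k 0 - ∑ i, colPart X.1 i * (low p i).1 k 0 := by
    simp [Matrix.sum_apply]
  rw [hs]
  rcases index_cases k with rfl | ⟨k, rfl⟩ | rfl
  · exact absurd rfl hk
  · have : ∀ i, (low p i).1 (mid k) 0 = (Pi.single i 1 : Fin n → ℂ) k := fun i =>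
      congrFun (colPart_low i) k
    simp [this, Pi.single_apply, colPart]
  · simp [soG_last_zero (Subtype.property _)]

/-- Elements of the parabolic have no 𝔫₋-part and every derivation kills constants, so only the
scalar term of lam − E survives. -/
lemma model_one (lam : ℂ) (X : parabolic n p) :
    model n p lam X 1 = chi n p lam X • (1 : MvPolynomial (Fin n) ℂ) := by
  have h : colPart X.1.1 = 0 := by ext i; exact X.2 _ (mid_ne_zero i)
  have hl : lin (0 : Fin n → ℂ) = 0 := by simp [lin]
  rw [model_apply, conf_apply, h, hl, lap_apply]
  simp [smul_eq_C_mul]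
  rw [mul_comm, ← map_mul]
  rfl

/-- The polynomial model is isomorphic to the scalar generalized Verma module. -/
lemma exists_verma_equiv_model (n p : ℕ) (lam : ℂ) :
    ∃ Φ : VermaG n p lam ≃ₗ[ℂ] MvPolynomial (Fin n) ℂ,
      ∀ (X : soG n p) m, Φ ⁅X, m⁆ = model n p lam X (Φ m) := by
  obtain ⟨F, hF1, hF⟩ := exists_inducedModule_lift (χ := chi n p lam) (model n p lam) 1
    (model_one lam)
  obtain ⟨φ, hφ1, hφ, hφs⟩ := exists_mvPolynomial_surjective (χ := chi n p lam) (low (n := n) p)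
    lie_low_low (fun X => colPart X.1) sub_sum_low_mem
  -- Both maps turn `low p i` into multiplication by `X i`. Since φ is onto, this left inverse also
  -- yields injectivity of `F`.
  have hid : ∀ f, F (φ f) = f := by
    intro f
    induction f using MvPolynomial.induction_on with
    | C a => rw [← mul_one (C a), ← smul_eq_C_mul, map_smul, map_smul, hφ1, hF1]
    | add f g hf hg => rw [map_add, map_add, hf, hg]
    | mul_X f i hf => rw [mul_comm, hφ, hF, hf, model_low]
  refine ⟨LinearEquiv.ofBijective F ⟨fun x y h => ?_, fun f => ⟨φ f, hid f⟩⟩, hF⟩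
  obtain ⟨f, rfl⟩ := hφs x
  obtain ⟨g, rfl⟩ := hφs y
  rw [hid, hid] at h
  rw [h]

end Model

/-! ### Singular vectors -/

section Singular

open MvPolynomial Matrix

variable {m : ℕ}

/-- The variable of the direction that is normal to the smaller algebra. -/
def normalVar (m : ℕ) : MvPolynomial (Fin (m + 1)) ℂ := X (Fin.last m)

/-- The quadratic form in the tangential variables. -/
def quad (ε : Fin (m + 1) → ℂ) : MvPolynomial (Fin (m + 1)) ℂ :=
  ∑ i : Fin m, C (ε i.castSucc) * X i.castSucc ^ 2

/-- A derivation that kills the normal variable can thus be computed on the full quadratic form,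
with sums over all indices. -/
lemma quad_eq (ε : Fin (m + 1) → ℂ) :
    quad ε = ∑ i, C (ε i) * (X i * X i) - C (ε (Fin.last m)) * (normalVar m * normalVar m) := by
  rw [Fin.sum_univ_castSucc, normalVar, add_sub_cancel_right]
  simp [quad, sq]

lemma dd_normalVar {w : Fin (m + 1) → ℂ} (hw : w (Fin.last m) = 0) : dd w (normalVar m) = 0 := by
  rw [normalVar, dd_X, hw, map_zero]

lemma rot_normalVar {A : Matrix (Fin (m + 1)) (Fin (m + 1)) ℂ} (hA : ∀ i, A i (Fin.last m) = 0) :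
    rot A (normalVar m) = 0 := by
  simp [normalVar, lin, hA]

lemma dd_quad (ε : Fin (m + 1) → ℂ) {w : Fin (m + 1) → ℂ} (hw : w (Fin.last m) = 0) :
    dd w (quad ε) = 2 * lin (ε * w) := by
  simp only [quad_eq, map_sub, map_sum, Derivation.leibniz, derivation_C, dd_normalVar hw,
    dd_X, lin, Finset.mul_sum, smul_eq_mul, mul_zero, add_zero, sub_zero, Pi.mul_apply, map_mul]
  exact Finset.sum_congr rfl fun i _ => by ring

lemma eul_quad (ε : Fin (m + 1) → ℂ) : eul (quad ε) = 2 * quad ε := by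
  simp only [quad, map_sum, derivation_C_mul', Derivation.leibniz_pow, eul_X, Finset.mul_sum]
  refine Finset.sum_congr rfl fun i _ => ?_
  simp only [smul_eq_mul, nsmul_eq_mul]
  push_cast
  ring

lemma rot_quad {ε : Fin (m + 1) → ℂ} {A : Matrix (Fin (m + 1)) (Fin (m + 1)) ℂ}
    (hA : ∀ i j, ε i * A i j = -(ε j * A j i)) (hA0 : ∀ i, A i (Fin.last m) = 0)
    (hε : ∀ i, ε i * ε i = 1) : rot A (quad ε) = 0 := by
  have h1 : rot A (quad ε) = ∑ i, ∑ j, C (2 * ε i * A j i) * (X i * X j) := by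
    simp only [quad_eq, map_sub, map_sum, Derivation.leibniz, derivation_C,
      rot_normalVar hA0, rot_X, smul_eq_mul, mul_zero, add_zero, sub_zero]
    refine Finset.sum_congr rfl fun i _ => ?_
    rw [← two_mul, lin, Finset.mul_sum, Finset.mul_sum, Finset.mul_sum]
    refine Finset.sum_congr rfl fun j _ => ?_
    simp only [map_mul, map_ofNat]
    ring
  -- Skewness with the signs on the other side, available because ε² = 1.
  have hA' : ∀ i j, ε i * A j i = -(ε j * A i j) := fun i j => by
    linear_combination (ε i * ε j) * (hA i j) - (ε j * A i j) * hε i - (ε i * A j i) * hε j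
  have h2 : rot A (quad ε) = -rot A (quad ε) := by
    conv_lhs => rw [h1, Finset.sum_comm]
    rw [h1, ← Finset.sum_neg_distrib]
    refine Finset.sum_congr rfl fun i _ => ?_
    rw [← Finset.sum_neg_distrib]
    refine Finset.sum_congr rfl fun j _ => ?_
    rw [mul_assoc, mul_assoc, hA' j i, mul_comm (X j), mul_neg, map_neg, neg_mul]
  exact self_eq_neg.1 h2

/-! ### The Laplacian and the Euler field on the products q^j t^k -/

lemma lap_X_mul {ι : Type*} [Fintype ι] (ε : ι → ℂ) (i : ι) (f : MvPolynomial ι ℂ) :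
    lap ε (X i * f) = X i * lap ε f + C (ε i) * pderiv i f := by
  classical
  have h : lin (Pi.single i 1 : ι → ℂ) = X i := by simp [lin, Pi.single_apply]
  have h2 : ε * Pi.single i 1 = ε i • (Pi.single i 1 : ι → ℂ) := by
    ext j; by_cases hj : j = i
    · subst hj; simp
    · simp [hj]
  rw [← h, lap_lin, h2, dd_smul, ← pderiv_eq_dd]

lemma eul_eq_sum {ι : Type*} [Fintype ι] (f : MvPolynomial ι ℂ) :
    eul f = ∑ i, X i * pderiv i f := by
  classical
  have : (eul : Derivation ℂ (MvPolynomial ι ℂ) _) = ∑ k, (X k : MvPolynomial ι ℂ) • pderiv k :=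
    derivation_ext fun i => by
      rw [derivation_sum_apply]
      simp [pderiv_X, Pi.single_apply]
  rw [this, derivation_sum_apply]
  simp

/-- Each of the m tangential variables contributes one f, and the bracket is the tangential Euler
field applied to f. -/
lemma lap_quad_mul {ε : Fin (m + 1) → ℂ} (hε : ∀ i, ε i * ε i = 1)
    (f : MvPolynomial (Fin (m + 1)) ℂ) :
    lap ε (quad ε * f) = quad ε * lap ε f
      + 2 * (eul f - normalVar m * pderiv (Fin.last m) f) + C (m : ℂ) * f := by
  have h1 : ∀ i, lap ε (C (ε i) * X i ^ 2 * f) = C (ε i) * X i ^ 2 * lap ε f +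
      2 * (X i * pderiv i f) + f := by
    intro i
    have hC : (C (ε i) : MvPolynomial (Fin (m + 1)) ℂ) * C (ε i) = 1 := by
      rw [← map_mul, hε, map_one]
    rw [mul_assoc, map_C_mul', sq, mul_assoc, lap_X_mul, lap_X_mul, pderiv_mul, pderiv_X_self]
    linear_combination (2 * X i * pderiv i f + f) * hC
  rw [eul_eq_sum, Fin.sum_univ_castSucc, normalVar, add_sub_cancel_right, quad, Finset.sum_mul,
    map_sum, Finset.sum_congr rfl fun i _ => h1 _, Finset.sum_add_distrib, Finset.sum_add_distrib,
    ← Finset.sum_mul, ← Finset.mul_sum]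
  simp

lemma eul_normalVar_pow (k : ℕ) : eul (normalVar m ^ k) = C (k : ℂ) * normalVar m ^ k := by
  rcases k with _ | k
  · simp
  · rw [Derivation.leibniz_pow, normalVar, eul_X]
    simp only [smul_eq_mul, nsmul_eq_mul, map_natCast]
    push_cast
    ring

lemma pderiv_normalVar_pow (k : ℕ) :
    pderiv (Fin.last m) (normalVar m ^ k) = C (k : ℂ) * normalVar m ^ (k - 1) := by
  rw [Derivation.leibniz_pow, normalVar, pderiv_X_self]
  simp

lemma pderiv_last_quad (ε : Fin (m + 1) → ℂ) : pderiv (Fin.last m) (quad ε) = 0 := by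
  rw [quad, map_sum]
  refine Finset.sum_eq_zero fun i _ => ?_
  rw [derivation_C_mul', Derivation.leibniz_pow, pderiv_X_of_ne (Fin.castSucc_lt_last i).ne]
  simp

lemma eul_quad_pow_mul (ε : Fin (m + 1) → ℂ) (j k : ℕ) :
    eul (quad ε ^ j * normalVar m ^ k) = C (2 * j + k : ℂ) * (quad ε ^ j * normalVar m ^ k) := by
  rw [Derivation.leibniz, eul_normalVar_pow, Derivation.leibniz_pow, eul_quad]
  rcases j with _ | j
  · simp
  · simp only [smul_eq_mul, nsmul_eq_mul, map_natCast, map_add, map_mul, map_ofNat]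
    push_cast
    ring

/-- The truncated exponent k − 2 is harmless: for k < 2 the coefficient k(k − 1) vanishes. -/
lemma lap_normalVar_pow (ε : Fin (m + 1) → ℂ) (k : ℕ) :
    lap ε (normalVar m ^ k) = C (ε (Fin.last m) / 2 * (k * (k - 1))) * normalVar m ^ (k - 2) := by
  induction k with
  | zero => simp [lap_apply]
  | succ k ih =>
    have h : normalVar m * (C (ε (Fin.last m) / 2 * (k * (k - 1))) * normalVar m ^ (k - 2)) =
        C (ε (Fin.last m) / 2 * (k * (k - 1))) * normalVar m ^ (k - 1) := by
      rcases k with _ | _ | k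
      · simp
      · simp
      · rw [show k + 1 + 1 - 2 = k by omega, Nat.add_sub_cancel]; ring
    have h' : (C (ε (Fin.last m) / 2 * (((k + 1 : ℕ) : ℂ) * (((k + 1 : ℕ) : ℂ) - 1))) :
        MvPolynomial (Fin (m + 1)) ℂ) =
        C (ε (Fin.last m) / 2 * (k * (k - 1))) + C (ε (Fin.last m)) * C (k : ℂ) := by
      rw [← map_mul, ← map_add]
      congr 1
      push_cast
      ring
    rw [pow_succ', normalVar, lap_X_mul, ← normalVar, ih, pderiv_normalVar_pow, h, h',
      show k + 1 - 2 = k - 1 by omega]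
    ring

lemma lap_quad_pow_succ_mul {ε : Fin (m + 1) → ℂ} (hε : ∀ i, ε i * ε i = 1) (j k : ℕ) :
    lap ε (quad ε ^ (j + 1) * normalVar m ^ k) =
      C (ε (Fin.last m) / 2 * (k * (k - 1))) * (quad ε ^ (j + 1) * normalVar m ^ (k - 2))
      + C ((j + 1) * (2 * j + m) : ℂ) * (quad ε ^ j * normalVar m ^ k) := by
  have hp : ∀ j, normalVar m * pderiv (Fin.last m) (quad ε ^ j * normalVar m ^ k) =
      C (k : ℂ) * (quad ε ^ j * normalVar m ^ k) := by
    intro j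
    rw [Derivation.leibniz, pderiv_normalVar_pow, Derivation.leibniz_pow, pderiv_last_quad]
    rcases k with _ | k
    · simp
    · simp only [smul_eq_mul, Nat.add_sub_cancel]
      ring
  induction j with
  | zero =>
    rw [zero_add, pow_one, lap_quad_mul hε, lap_normalVar_pow, eul_normalVar_pow]
    have := hp 0
    rw [pow_zero, one_mul] at this
    rw [this]
    simp
    ring
  | succ j ih =>
    rw [pow_succ', mul_assoc, lap_quad_mul hε, ih, hp, eul_quad_pow_mul]
    simp only [map_add, map_mul, map_natCast, map_ofNat, map_one]
    push_cast
    ring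

/-! ### The singular vectors and their recursion -/

/-- The coefficients of the singular vector of degree `b`. -/
def singularCoeff (c lam : ℂ) (m b : ℕ) : ℕ → ℂ
  | 0 => 1
  | j + 1 => -(singularCoeff c lam m b j *
      (c / 2 * ((b - 2 * j : ℕ) * ((b - 2 * j : ℕ) - 1)))) /
        ((j + 1) * (2 * (lam - b + 1) + 2 * j + m))

/-- The singular vector of degree `b`, a Gegenbauer polynomial in the normal variable. -/
def singularVec (ε : Fin (m + 1) → ℂ) (lam : ℂ) (b : ℕ) : MvPolynomial (Fin (m + 1)) ℂ :=
  ∑ j ∈ Finset.range (b / 2 + 1), C (singularCoeff (ε (Fin.last m)) lam m b j) *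
    (quad ε ^ j * normalVar m ^ (b - 2 * j))

lemma eul_singularVec (ε : Fin (m + 1) → ℂ) (lam : ℂ) (b : ℕ) :
    eul (singularVec ε lam b) = C (b : ℂ) * singularVec ε lam b := by
  rw [singularVec, map_sum, Finset.mul_sum]
  refine Finset.sum_congr rfl fun j hj => ?_
  have hj : 2 * j ≤ b := by have := Finset.mem_range.1 hj; omega
  rw [derivation_C_mul', eul_quad_pow_mul, Nat.cast_sub hj]
  push_cast
  rw [add_sub_cancel]
  ring

lemma rot_singularVec {ε : Fin (m + 1) → ℂ} {A : Matrix (Fin (m + 1)) (Fin (m + 1)) ℂ}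
    (hA : ∀ i j, ε i * A i j = -(ε j * A j i)) (hA0 : ∀ i, A i (Fin.last m) = 0)
    (hε : ∀ i, ε i * ε i = 1) (lam : ℂ) (b : ℕ) : rot A (singularVec ε lam b) = 0 := by
  rw [singularVec, map_sum]
  refine Finset.sum_eq_zero fun j _ => ?_
  rw [derivation_C_mul', Derivation.leibniz, Derivation.leibniz_pow, Derivation.leibniz_pow,
    rot_quad hA hA0 hε, rot_normalVar hA0]
  simp

/-- On each summand of the singular vector the 𝔫₊-operator produces at most two terms of the form
h_j = ⟨εw, x⟩ q^j t^(b−2j−2), with neighbouring indices. The recursion for `singularCoeff` cancels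
them in pairs, so the sum telescopes. -/
lemma nplus_singularVec {ε w : Fin (m + 1) → ℂ} (hε : ∀ i, ε i * ε i = 1)
    (hw : w (Fin.last m) = 0) {lam : ℂ} {b : ℕ}
    (hlam : ∀ j, 2 * (j + 1) ≤ b → 2 * (lam - b + 1) + 2 * j + m ≠ 0) :
    C lam * dd w (singularVec ε lam b) - eul (dd w (singularVec ε lam b))
      + lin (ε * w) * lap ε (singularVec ε lam b) = 0 := by
  set c := ε (Fin.last m) with hc
  let P : MvPolynomial (Fin (m + 1)) ℂ →ₗ[ℂ] MvPolynomial (Fin (m + 1)) ℂ :=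
    (lam • LinearMap.id - eul.toLinearMap) ∘ₗ (dd w).toLinearMap
      + LinearMap.mulLeft ℂ (lin (ε * w)) ∘ₗ lap ε
  have hP : ∀ f, P f = C lam * dd w f - eul (dd w f) + lin (ε * w) * lap ε f := fun f => by
    simp [P, smul_eq_C_mul]
  rw [← hP]
  let β : ℕ → ℂ := fun j => c / 2 * ((b - 2 * j : ℕ) * ((b - 2 * j : ℕ) - 1))
  let h : ℕ → MvPolynomial (Fin (m + 1)) ℂ := fun j =>
    lin (ε * w) * (quad ε ^ j * normalVar m ^ (b - 2 * (j + 1)))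
  have h0 : P (quad ε ^ 0 * normalVar m ^ (b - 2 * 0)) = C (β 0) * h 0 := by
    rw [hP, pow_zero, one_mul, lap_normalVar_pow, Derivation.leibniz_pow, dd_normalVar hw]
    simp only [β, h, smul_zero, map_zero, mul_zero, pow_zero, one_mul, Nat.sub_zero, zero_add,
      mul_one, sub_zero, ← hc]
    ring
  -- The derivative along w has degree b − 1, so the first-order part gives 2(j+1)(lam − b + 1); the
  -- Laplacian gives (j+1)(2j + m) on h_j and β on h_(j+1).
  have hS : ∀ j, 2 * (j + 1) ≤ b → P (quad ε ^ (j + 1) * normalVar m ^ (b - 2 * (j + 1))) =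
      C (β (j + 1)) * h (j + 1) + C ((j + 1) * (2 * (lam - b + 1) + 2 * j + m)) * h j := by
    intro j hj
    have hd : dd w (quad ε ^ (j + 1) * normalVar m ^ (b - 2 * (j + 1))) =
        C (2 * (j + 1) : ℂ) * (lin (ε * w) * (quad ε ^ j * normalVar m ^ (b - 2 * (j + 1)))) := by
      rw [Derivation.leibniz, Derivation.leibniz_pow, Derivation.leibniz_pow, dd_normalVar hw,
        dd_quad ε hw]
      simp only [smul_eq_mul, nsmul_eq_mul, Nat.add_sub_cancel, map_mul, map_add,
        map_natCast, map_one, map_ofNat]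
      push_cast
      ring
    have hk : b - 2 * (j + 1) - 2 = b - 2 * (j + 1 + 1) := by omega
    rw [hP, hd, derivation_C_mul', Derivation.leibniz, eul_lin, eul_quad_pow_mul,
      lap_quad_pow_succ_mul hε, hk, ← hc]
    have hb : (C (b : ℂ) : MvPolynomial (Fin (m + 1)) ℂ) =
        2 * (C (j : ℂ) + 1) + C ((b - 2 * (j + 1) : ℕ) : ℂ) := by
      have : (b : ℂ) = 2 * (j + 1) + (b - 2 * (j + 1) : ℕ) := by
        rw [Nat.cast_sub hj]; push_cast; ring
      conv_lhs => rw [this]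
      simp only [map_add, map_mul, map_ofNat, map_one]
    simp only [β, h, smul_eq_mul, map_mul, map_add, map_sub, map_one, map_ofNat, hb]
    ring
  rw [singularVec, map_sum, Finset.sum_congr rfl fun j _ => map_C_mul' P _ _,
    Finset.sum_range_succ', h0, singularCoeff, map_one, one_mul]
  have hrec : ∀ j ∈ Finset.range (b / 2), C (singularCoeff c lam m b (j + 1)) *
      P (quad ε ^ (j + 1) * normalVar m ^ (b - 2 * (j + 1))) =
      C (singularCoeff c lam m b (j + 1) * β (j + 1)) * h (j + 1)
        - C (singularCoeff c lam m b j * β j) * h j := by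
    intro j hj
    have hj : 2 * (j + 1) ≤ b := by have := Finset.mem_range.1 hj; omega
    have hne : ((j + 1) * (2 * (lam - b + 1) + 2 * j + m) : ℂ) ≠ 0 :=
      mul_ne_zero (Nat.cast_add_one_ne_zero j) (hlam j hj)
    have : singularCoeff c lam m b (j + 1) * ((j + 1) * (2 * (lam - b + 1) + 2 * j + m)) =
        -(singularCoeff c lam m b j * β j) := by
      rw [singularCoeff, div_mul_cancel₀ _ hne]
    have this := congrArg (C : ℂ → MvPolynomial (Fin (m + 1)) ℂ) this
    rw [map_mul C (singularCoeff c lam m b (j + 1)), map_neg] at this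
    rw [hS j hj, map_mul C (singularCoeff c lam m b (j + 1)) (β (j + 1))]
    linear_combination h j * this
  rw [Finset.sum_congr rfl hrec,
    Finset.sum_range_sub (fun j => C (singularCoeff c lam m b j * β j) * h j)]
  -- The boundary term at the top vanishes: the remaining power of t is 0 or 1, which the second
  -- normal derivative kills. The one at the bottom cancels the contribution of j = 0.
  have hlast : β (b / 2) = 0 := by
    have : b - 2 * (b / 2) = 0 ∨ b - 2 * (b / 2) = 1 := by omega
    rcases this with h | h <;> simp [β, h]
  simp [hlast, singularCoeff]

/-! ### Monicity in the normal variable -/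

/-- Polynomials in all variables, as polynomials in the normal variable. -/
def normalEquiv (m : ℕ) :
    MvPolynomial (Fin (m + 1)) ℂ ≃ₐ[ℂ] Polynomial (MvPolynomial (Fin m) ℂ) :=
  (renameEquiv ℂ finSuccEquivLast).trans (optionEquivLeft ℂ (Fin m))

lemma normalEquiv_normalVar : normalEquiv m (normalVar m) = Polynomial.X := by
  simp [normalEquiv, normalVar]

lemma normalEquiv_castSucc (i : Fin m) :
    normalEquiv m (X i.castSucc) = Polynomial.C (X i) := by
  simp [normalEquiv]

lemma normalEquiv_C (c : ℂ) : normalEquiv m (C c) = Polynomial.C (C c) := by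
  simp [normalEquiv]

lemma exists_normalEquiv_quad (ε : Fin (m + 1) → ℂ) :
    ∃ q, normalEquiv m (quad ε) = Polynomial.C q := by
  refine ⟨∑ i : Fin m, C (ε i.castSucc) * X i ^ 2, ?_⟩
  simp only [quad, map_sum, map_mul, map_pow, normalEquiv_C, normalEquiv_castSucc]

lemma exists_normalEquiv_singularVec (ε : Fin (m + 1) → ℂ) (lam : ℂ) (b : ℕ) :
    ∃ r : Polynomial (MvPolynomial (Fin m) ℂ), r.degree < b ∧
      normalEquiv m (singularVec ε lam b) = Polynomial.X ^ b + r := by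
  obtain ⟨q, hq⟩ := exists_normalEquiv_quad ε
  rw [singularVec, Finset.sum_range_succ', map_add, add_comm]
  refine ⟨_, ?_, by
    rw [singularCoeff]; simp only [map_one, pow_zero, one_mul, map_pow, normalEquiv_normalVar,
      mul_zero, Nat.sub_zero]; rfl⟩
  rw [map_sum, ← Polynomial.mem_degreeLT]
  refine Submodule.sum_mem _ fun j hj => ?_
  rw [Polynomial.mem_degreeLT]
  -- The subtraction is truncated, so the strict drop in degree needs b > 0, which j < b/2 provides.
  have hj : b - 2 * (j + 1) < b := by have := Finset.mem_range.1 hj; omega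
  rw [map_mul, map_mul, map_pow, map_pow, normalEquiv_C, hq, normalEquiv_normalVar, ← mul_assoc,
    ← map_pow, ← map_mul]
  exact (Polynomial.degree_C_mul_X_pow_le _ _).trans_lt (by exact_mod_cast hj)

/-- The singular vectors form a basis over the polynomials in the tangential variables. -/
lemma exists_singularVec_basis (ε : Fin (m + 1) → ℂ) (lam : ℂ) :
    ∃ B : Module.Basis ℕ (MvPolynomial (Fin m) ℂ) (Polynomial (MvPolynomial (Fin m) ℂ)),
      ∀ b, B b = normalEquiv m (singularVec ε lam b) := by
  choose r hr hrb using exists_normalEquiv_singularVec ε lam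
  let S : Polynomial.Sequence (MvPolynomial (Fin m) ℂ) :=
    { elems' := fun b => normalEquiv m (singularVec ε lam b)
      degree_eq' := fun b => by 
        rw [hrb, Polynomial.degree_add_eq_left_of_degree_lt] <;> rw [Polynomial.degree_X_pow]
        exact hr b }
  have hS : ∀ b, IsUnit (S b).leadingCoeff := fun b => by
    have : (S b).Monic := by
      change (normalEquiv m (singularVec ε lam b)).Monic
      rw [hrb]
      exact Polynomial.monic_X_pow_add (hr b)
    rw [this.leadingCoeff]
    exact isUnit_one
  exact ⟨S.basis hS, fun b => S.basis_eq_self hS b⟩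

end Singular

/-! ### Branching -/

section Branching

open MvPolynomial Matrix

variable {m p : ℕ}

lemma mem_soG'_iff (X : soG (m + 1) p) :
    X ∈ soG' (m + 1) p ↔ ∀ k, X.1 k (mid (Fin.last m)) = 0 := by
  have h : X ∈ soG' (m + 1) p ↔ X.1.mulVec (Pi.single (mid (Fin.last m)) 1) = 0 := Iff.rfl
  rw [h, mulVec_single_one, funext_iff]
  rfl

lemma soG'_normal (X : soG' (m + 1) p) (k : Fin (m + 3)) :
    X.1.1 k (mid (Fin.last m)) = 0 := (mem_soG'_iff X.1).1 X.2 k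

/-- The column of e_n vanishes by definition of g'; its bottom entry is, up to sign, the entry of
the first column in question. -/
lemma soG'_colPart_last (X : soG' (m + 1) p) : colPart X.1.1 (Fin.last m) = 0 := by
  have h := soG_last_mid X.1.2 (Fin.last m)
  rw [soG'_normal] at h
  have h2 := eps_mul_self (p := p) (Fin.last m)
  change X.1.1 (mid (Fin.last m)) 0 = 0
  linear_combination (eps (m + 1) p (Fin.last m)) * h - X.1.1 (mid (Fin.last m)) 0 * h2

lemma low_castSucc_mem (i : Fin m) : low p i.castSucc ∈ soG' (m + 1) p := by
  rw [mem_soG'_iff]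
  have hi : i.castSucc ≠ Fin.last m := (Fin.castSucc_lt_last i).ne
  intro k
  simp [low, lowMatrix, (mid_ne_zero _).symm, mid_injective.eq_iff, hi]

/-- The root vector of `𝔫₋ ∩ g'` that maps `e_0` to `e_{i+1}`. -/
def low' (p : ℕ) (i : Fin m) : soG' (m + 1) p := ⟨low p i.castSucc, low_castSucc_mem i⟩

lemma sub_sum_low'_mem (X : soG' (m + 1) p) :
    X - ∑ i, colPart X.1.1 (Fin.castSucc i) • low' p i ∈ parabolic' (m + 1) p := by
  change (X - ∑ i, colPart X.1.1 (Fin.castSucc i) • low' p i).1 ∈ parabolic (m + 1) p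
  have h := sub_sum_low_mem X.1
  rw [Fin.sum_univ_castSucc, soG'_colPart_last, zero_smul, add_zero] at h
  convert h using 1
  simp [low']

/-- In degree b the operator lam − E is the scalar lam − b; rotations and 𝔫₊ ∩ g' annihilate the
vector. -/
lemma model_singularVec {lam : ℂ} {b : ℕ}
    (hlam : ∀ j, 2 * (j + 1) ≤ b → 2 * (lam - b + 1) + 2 * j + m ≠ 0)
    (X : parabolic' (m + 1) p) :
    model (m + 1) p lam X.1.1 (singularVec (eps (m + 1) p) lam b) =
      chi' (m + 1) p (lam - b) X • singularVec (eps (m + 1) p) lam b := by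
  have hu : colPart X.1.1.1 = 0 := by ext i; exact X.2 _ (mid_ne_zero i)
  have hl : lin (0 : Fin (m + 1) → ℂ) = 0 := by simp [lin]
  have hr := rot_singularVec (A := midPart X.1.1.1) (soG_mid_mid X.1.1.2)
    (fun i => soG'_normal X.1 (mid i)) eps_mul_self lam b
  have hn := nplus_singularVec (w := rowPart X.1.1.1) (eps_mul_self (p := p))
    (soG'_normal X.1 0) hlam
  have hchi : chi' (m + 1) p (lam - b) X = (lam - b) * X.1.1.1 0 0 := rfl
  rw [model_apply, conf_apply, hu, hl, hr, eul_singularVec, hchi, smul_eq_C_mul, map_mul, map_sub]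
  linear_combination hn

/-- A family of module maps whose compositions with surjections from a ring `A` are the
multiplications of the elements of an `A`-basis induces a bijection from the direct sum. -/
lemma bijective_toModule_of_basis {k A N Q : Type*} [CommRing k] [CommRing A]
    [AddCommGroup N] [Module k N] [AddCommGroup Q] [Module A Q] {M : ℕ → Type*}
    [∀ b, AddCommGroup (M b)] [∀ b, Module k (M b)] (F : ∀ b, M b →ₗ[k] N) (φ : ∀ b, A →+ M b)
    (hφ : ∀ b, Function.Surjective (φ b)) (e : N ≃+ Q) (B : Module.Basis ℕ A Q)
    (h : ∀ b f, e (F b (φ b f)) = f • B b) :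
    Function.Bijective (DirectSum.toModule k ℕ N F) := by
  classical
  set G := DirectSum.toModule k ℕ N F with hGdef
  have hG : ∀ b v, G (DirectSum.lof k ℕ M b v) = F b v := fun b v => DirectSum.toModule_lof k b v
  constructor
  · rw [injective_iff_map_eq_zero]
    intro v hv
    choose s hs using fun b => hφ b (v b)
    -- With each component of v lifted to a coefficient in A, the vanishing of G v becomes a linear
    -- relation among basis elements; injectivity of the individual F b is not needed beforehand.
    have hsum : ∑ b ∈ DFinsupp.support v, s b • B b = 0 := by
      rw [← map_zero e, ← hv, ← DirectSum.sum_support_of v, map_sum, map_sum,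
        DirectSum.sum_support_of]
      refine Finset.sum_congr rfl fun b _ => ?_
      rw [← h, hs]
      exact congrArg e (hG b (v b)).symm
    refine DFinsupp.ext fun b => ?_
    by_cases hb : b ∈ DFinsupp.support v
    · have := linearIndependent_iff'.1 B.linearIndependent _ _ hsum b hb
      rw [← hs, this, map_zero]; rfl
    · exact DFinsupp.notMem_support_iff.1 hb
  · intro f
    obtain ⟨c, hc⟩ := (Finsupp.mem_span_range_iff_exists_finsupp (R := A) (v := B)).1
      (B.mem_span (e f))
    refine ⟨∑ b ∈ c.support, DirectSum.lof k ℕ M b (φ b (c b)), e.injective ?_⟩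
    rw [← hc, map_sum, map_sum, Finsupp.sum]
    exact Finset.sum_congr rfl fun b _ => by rw [hG, h]

/-- A singular vector in a module gives a map from an induced module, which is determined on the
monomials in a commuting complement `Y` of `P`. -/
lemma exists_inducedModule_lift_mvPolynomial {R L : Type*} [CommRing R] [LieRing L]
    [LieAlgebra R L] {P : LieSubalgebra R L} {χ : LieAlgebra.LieCharacter R P}
    {N : Type*} [AddCommGroup N] [Module R N] (ρ : L →ₗ⁅R⁆ Module.End R N) (v : N)
    (hv : ∀ x : P, ρ x v = χ x • v) {ι : Type*} [Fintype ι] (Y : ι → L)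
    (hY : ∀ i j, ⁅Y i, Y j⁆ = 0) (c : L → ι → R) (hc : ∀ x, x - ∑ i, c x i • Y i ∈ P) :
    ∃ (F : InducedModule R P (CharModule χ) →ₗ[R] N)
      (φ : MvPolynomial ι R →ₗ[R] InducedModule R P (CharModule χ)),
      (∀ (x : L) m, F ⁅x, m⁆ = ρ x (F m)) ∧ Function.Surjective φ ∧ F (φ 1) = v ∧
      ∀ i f, F (φ (X i * f)) = ρ (Y i) (F (φ f)) := by
  obtain ⟨F, hF1, hF⟩ := exists_inducedModule_lift ρ v hv
  obtain ⟨φ, hφ1, hφ, hφs⟩ := exists_mvPolynomial_surjective (χ := χ) Y hY c hc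
  exact ⟨F, φ, hF, hφs, by rw [hφ1, hF1], fun i f => by rw [hφ, hF]⟩

/-- A singular vector gives a map from a generalized Verma module of `g'` to the model. -/
lemma exists_verma'_hom {lam : ℂ} {b : ℕ}
    (hlam : ∀ j, 2 * (j + 1) ≤ b → 2 * (lam - b + 1) + 2 * j + m ≠ 0) :
    ∃ (F : VermaG' (m + 1) p (lam - b) →ₗ[ℂ] MvPolynomial (Fin (m + 1)) ℂ)
      (φ : MvPolynomial (Fin m) ℂ →ₗ[ℂ] VermaG' (m + 1) p (lam - b)),
      (∀ (X : soG' (m + 1) p) v,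
        F ⁅X, v⁆ = (model (m + 1) p lam).comp (soG' (m + 1) p).incl X (F v)) ∧
      Function.Surjective φ ∧ F (φ 1) = singularVec (eps (m + 1) p) lam b ∧
      ∀ i f, F (φ (X i * f)) =
        (model (m + 1) p lam).comp (soG' (m + 1) p).incl (low' p i) (F (φ f)) :=
  exists_inducedModule_lift_mvPolynomial ((model (m + 1) p lam).comp (soG' (m + 1) p).incl) _
    (model_singularVec hlam) (low' (m := m) p) (fun _ _ => Subtype.ext (lie_low_low _ _))
    (fun X i => colPart X.1.1 i.castSucc) sub_sum_low'_mem

/-- Commuting with the tangential variables makes T linear over ℂ[x'], hence determined by its value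
at 1. -/
lemma normalEquiv_eq_smul (T : MvPolynomial (Fin m) ℂ →ₗ[ℂ] MvPolynomial (Fin (m + 1)) ℂ)
    (hT : ∀ i f, T (X i * f) = X i.castSucc * T f) (f : MvPolynomial (Fin m) ℂ) :
    normalEquiv m (T f) = f • normalEquiv m (T 1) := by
  induction f using MvPolynomial.induction_on with
  | C a =>
    rw [← mul_one (C a), ← smul_eq_C_mul, map_smul, map_smul, smul_assoc, one_smul]
  | add f g hf hg => rw [map_add, map_add, hf, hg, add_smul]
  | mul_X f i hf =>
    rw [mul_comm, hT, map_mul, normalEquiv_castSucc, hf, mul_smul, Polynomial.smul_eq_C_mul (X i)]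

/-- A family of module maps, from a direct sum of Lie modules, that intertwine a representation. -/
lemma toModule_lie {R L N : Type*} [CommRing R] [LieRing L] [LieAlgebra R L] [AddCommGroup N]
    [Module R N] (ρ : L →ₗ⁅R⁆ Module.End R N) {M : ℕ → Type*} [∀ b, AddCommGroup (M b)]
    [∀ b, Module R (M b)] [∀ b, LieRingModule L (M b)] [∀ b, LieModule R L (M b)]
    (F : ∀ b, M b →ₗ[R] N) (hF : ∀ b x m, F b ⁅x, m⁆ = ρ x (F b m)) (x : L) (v : ⨁ b, M b) :
    DirectSum.toModule R ℕ N F ⁅x, v⁆ = ρ x (DirectSum.toModule R ℕ N F v) := by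
  have h : ∀ b v, ⁅x, DirectSum.lof R ℕ M b v⁆ = DirectSum.lof R ℕ M b ⁅x, v⁆ := fun b v =>
    ((DirectSum.lieModuleOf R ℕ L M b).map_lie x v).symm
  induction v using DirectSum.induction_on with
  | zero => rw [lie_zero, map_zero, map_zero]
  | of b v =>
    rw [← DirectSum.lof_eq_of R, h, DirectSum.toModule_lof, DirectSum.toModule_lof, hF]
  | add v w hv hw => rw [lie_add, map_add, map_add, map_add, hv, hw]

/-- Maps from Lie modules to a polynomial model whose images of the generator form a basis over the
tangential polynomials assemble to an isomorphism from the direct sum. -/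
lemma exists_directSum_equiv_of_basis {L : Type*} [LieRing L] [LieAlgebra ℂ L]
    (ρ : L →ₗ⁅ℂ⁆ Module.End ℂ (MvPolynomial (Fin (m + 1)) ℂ)) (Y : Fin m → L)
    (hY : ∀ i f, ρ (Y i) f = X i.castSucc * f) (s : ℕ → MvPolynomial (Fin (m + 1)) ℂ)
    (B : Module.Basis ℕ (MvPolynomial (Fin m) ℂ) (Polynomial (MvPolynomial (Fin m) ℂ)))
    (hB : ∀ b, B b = normalEquiv m (s b)) {M : ℕ → Type*} [∀ b, AddCommGroup (M b)]
    [∀ b, Module ℂ (M b)] [∀ b, LieRingModule L (M b)] [∀ b, LieModule ℂ L (M b)]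
    (hM : ∀ b, ∃ (F : M b →ₗ[ℂ] MvPolynomial (Fin (m + 1)) ℂ)
      (φ : MvPolynomial (Fin m) ℂ →ₗ[ℂ] M b), (∀ (x : L) v, F ⁅x, v⁆ = ρ x (F v)) ∧
      Function.Surjective φ ∧ F (φ 1) = s b ∧ ∀ i f, F (φ (X i * f)) = ρ (Y i) (F (φ f))) :
    ∃ G : (⨁ b, M b) ≃ₗ[ℂ] MvPolynomial (Fin (m + 1)) ℂ,
      ∀ (x : L) v, G ⁅x, v⁆ = ρ x (G v) := by
  choose F φ hF hφ h1 hX using hM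
  have hbij := bijective_toModule_of_basis F (fun b => (φ b).toAddMonoidHom) hφ
    (normalEquiv m).toAddEquiv B fun b f => by
      rw [hB, ← h1]
      exact normalEquiv_eq_smul (F b ∘ₗ φ b) (fun i f => (hX b i f).trans (hY i _)) f
  exact ⟨LinearEquiv.ofBijective _ hbij, toModule_lie _ F hF⟩

/-- The restriction of the polynomial model decomposes into generalized Verma modules. -/
lemma exists_directSum_equiv {lam : ℂ}
    (hlam : ∀ b j : ℕ, 2 * (j + 1) ≤ b → 2 * (lam - b + 1) + 2 * j + m ≠ 0) :
    ∃ G : (⨁ b : ℕ, VermaG' (m + 1) p (lam - b)) ≃ₗ[ℂ] MvPolynomial (Fin (m + 1)) ℂ,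
      ∀ (X : soG' (m + 1) p) v, G ⁅X, v⁆ =
        (model (m + 1) p lam).comp (soG' (m + 1) p).incl X (G v) :=
  (exists_singularVec_basis (eps (m + 1) p) lam).elim fun B hB =>
    exists_directSum_equiv_of_basis _ (low' p) (fun i => model_low lam i.castSucc) _ B hB
      fun b => exists_verma'_hom (hlam b)

end Branching

end BranchingVerma

end

/-! ### Assembly of the two isomorphisms -/

open scoped DirectSum in
theorem mainTheorem7 (p q n : ℕ) (hp : 1 ≤ p) (hq : 2 ≤ q) (hn : n + 2 = p + q)
    (lam : ℂ) (hlam : ∀ k : ℕ, 2 ≤ k → lam ≠ ((k : ℂ) - (n : ℂ)) / 2) :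
    Nonempty (BranchingVerma.VermaG n p lam ≃ₗ⁅ℂ, BranchingVerma.soG' n p⁆
      (⨁ b : ℕ, BranchingVerma.VermaG' n p (lam - (b : ℂ)))) := by
  obtain ⟨m, rfl⟩ : ∃ m, n = m + 1 := ⟨n - 1, by omega⟩
  have hlam' : ∀ b j : ℕ, 2 * (j + 1) ≤ b → 2 * (lam - b + 1) + 2 * j + m ≠ 0 := by
    intro b j hj h
    -- Solving 2(lam − b + 1) + 2j + m = 0 with n = m + 1 gives lam = (k − n)/2 for k = 2b − 2j − 1.
    refine hlam (2 * b - 2 * j - 1) (by omega) ?_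
    rw [Nat.cast_sub (by omega), Nat.cast_sub (by omega)]
    push_cast
    linear_combination h / 2
  obtain ⟨Φ, hΦ⟩ := BranchingVerma.exists_verma_equiv_model (m + 1) p lam
  obtain ⟨G, hG⟩ := BranchingVerma.exists_directSum_equiv (p := p) hlam'
  refine ⟨{ (Φ.trans G.symm) with map_lie' := ?_ }⟩
  intro X v
  change G.symm (Φ ⁅X.1, v⁆) = ⁅X, G.symm (Φ v)⁆
  rw [LinearEquiv.symm_apply_eq, hG, LinearEquiv.apply_symm_apply, hΦ]
  rfl
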